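/- Let $\mathbb D=\{z\in\mathbb C:|z|<1\}$ and let $K,\delta$ be real numbers with $0\le\delta\le 2$ and $2\le K\le 4-\delta$. Let $h$ be analytic and locally univalent (locally injective) in $\mathbb D$, normalized by $h(0)=0$, $h'(0)=1$, and of boundary rotation at most $K\pi$, that is, $$\int_0^{2\pi}\left|\operatorname{Re}\left(1+\frac{re^{i\theta}h''(re^{i\theta})}{h'(re^{i\theta})}\right)\right|d\theta\le K\pi\qquad\text{for all } 0<r<1 .$$ Let $g$ be analytic in $\mathbb D$ with $g'(z)=\omega(z)h'(z)$ for $z\in\mathbb D$, where the dilatation $\omega$ satisfies $|\omega(z)|<\sin(\delta\pi/4)$ for all $z\in\mathbb D$. Then the harmonic mapping $f=h+\overline g$ is univalent (injective) in $\mathbb D$ and close-to-convex, i.e. the complement $\mathbb C\setminus f(\mathbb D)$ is a (possibly empty) union of closed half-lines with pairwise disjoint interiors, where the interior of a half-line is the half-line without its endpoint. -/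

import Mathlib

open Complex Set Metric Topology
open scoped Real ComplexConjugate

/-- `h` is locally univalent in the open unit disk: every point of the disk has a neighbourhood
on which `h` is injective. -/
def LocallyUnivalentOnDisk (h : ℂ → ℂ) : Prop :=
  ∀ z ∈ ball (0 : ℂ) 1, ∃ U ∈ 𝓝 z, InjOn h U

/-- The class `𝒱_K` of normalized, locally univalent analytic functions on the open unit disk
with boundary rotation at most `K π`. -/
structure BoundaryRotationClass (K : ℝ) (h : ℂ → ℂ) : Prop where
  analytic : AnalyticOnNhd ℂ h (ball 0 1)
  map_zero : h 0 = 0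
  deriv_zero : deriv h 0 = 1
  locallyUnivalent : LocallyUnivalentOnDisk h
  rotation_le : ∀ r : ℝ, 0 < r → r < 1 →
    ∫ θ in (0 : ℝ)..(2 * π),
      |(1 + (r * exp (θ * I)) * deriv (deriv h) (r * exp (θ * I)) /
          deriv h (r * exp (θ * I))).re| ≤ K * π

/-- The closed half-line with origin `a` and direction `v` (meant for `v ≠ 0`). -/
def closedHalfLine (a v : ℂ) : Set ℂ := {w | ∃ t : ℝ, 0 ≤ t ∧ w = a + t * v}

/-- The interior of that half-line: the half-line without its origin. -/
def openHalfLine (a v : ℂ) : Set ℂ := {w | ∃ t : ℝ, 0 < t ∧ w = a + t * v}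

/-- A plane set is close-to-convex if its complement is a union of closed half-lines with pairwise
disjoint interiors. A half-line is encoded by its origin and its unit direction vector, which it
determines uniquely. -/
def IsCloseToConvexSet (Ω : Set ℂ) : Prop :=
  ∃ S : Set (ℂ × ℂ),
    (∀ p ∈ S, ‖p.2‖ = 1) ∧
    Ωᶜ = ⋃ p ∈ S, closedHalfLine p.1 p.2 ∧
    ∀ p ∈ S, ∀ q ∈ S, p ≠ q → Disjoint (openHalfLine p.1 p.2) (openHalfLine q.1 q.2)

/-- A function on the open unit disk is univalent if it is injective there. -/
def IsUnivalentOnDisk (f : ℂ → ℂ) : Prop := InjOn f (ball 0 1)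

/-- A function on the open unit disk is close-to-convex if it is univalent with
close-to-convex range. -/
def IsCloseToConvexOnDisk (f : ℂ → ℂ) : Prop :=
  IsUnivalentOnDisk f ∧ IsCloseToConvexSet (f '' ball 0 1)

/-! On the circle `|z| = r` let `H θ` be the argument of `z h'(z)`. It gains `2π` per turn and has
variation at most `Kπ`, so it never drops by more than `(K - 2)π/2`, and it stays within `(K -
2)π/4` of a nondecreasing `s` (`exists_monotone_angle`). The tangent of `f` along the circle is `i
(z h' - conj (z g'))`. Since `K ≤ 4 - δ`, `cos (H - s) ≥ sin (δπ/4)`, which exceeds `|g'/h'|`; hence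
the tangent points to the left of the direction `exp (i s)`. Call the rays leaving the curve in
these directions outward.

Let `q` lie off the curve, with winding number `n` and `β` a continuous argument of `q - f`. Then
`q` is on the outward ray at `θ` exactly when `β - s` is a multiple of `2π` there, and the tangent
condition with the monotonicity of `s` lets `β - s` cross such levels only downwards. Over a turn `β
- s` changes by `2π(n - 1)`. Hence `n ≤ 1`, `n = 0` exactly when `q` is on an outward ray, and all
outward rays through `q` are parallel. Because `|g'| < |h'|`, each zero of `f - q` counts `+1` in a
topological argument principle (`exists_arg_lift_card_zeros`), so `n` is the number of preimages of
`q` in the disk. Thus `f` is injective, and the outside of the image of each closed disk is filled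
by noncrossing rays.

As `r → 1`, compactness of the unit circle gives every point outside the full image a ray that
avoids the image, and no two of these rays cross transversally. Rays lying on a common line are
merged into maximal half-lines (`IsCloseToConvexSet.of_rayField`). -/

/-! ### Downward level crossings of real functions -/

/-- A function with negative derivative at a zero is negative to the right of it and positive to
the left. -/
theorem HasDerivAt.eventually_sign_of_neg {ψ : ℝ → ℝ} {c x : ℝ} (hψ : HasDerivAt ψ c x)
    (h0 : ψ x = 0) (hc : c < 0) :
    (∀ᶠ y in 𝓝[>] x, ψ y < 0) ∧ ∀ᶠ y in 𝓝[<] x, 0 < ψ y := by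
  have h1 := (hasDerivAt_iff_tendsto_slope.1 hψ).eventually (gt_mem_nhds hc)
  have key : ∀ y, slope ψ x y = (y - x)⁻¹ * ψ y := fun y => by simp [slope, h0]
  constructor
  · have h2 : ∀ᶠ y in 𝓝[>] x, slope ψ x y < 0 :=
      h1.filter_mono (nhdsWithin_mono _ fun y (hy : x < y) => hy.ne')
    filter_upwards [h2, self_mem_nhdsWithin] with y hy hxy
    have hxy : 0 < y - x := sub_pos.2 hxy
    rw [key] at hy
    by_contra hcon
    exact absurd hy (not_lt.2 (mul_nonneg (inv_pos.2 hxy).le (not_lt.1 hcon)))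
  · have h2 : ∀ᶠ y in 𝓝[<] x, slope ψ x y < 0 :=
      h1.filter_mono (nhdsWithin_mono _ fun y (hy : y < x) => hy.ne)
    filter_upwards [h2, self_mem_nhdsWithin] with y hy hxy
    have hxy : y - x < 0 := sub_neg.2 hxy
    rw [key] at hy
    by_contra hcon
    exact absurd hy (not_lt.2 (mul_nonneg_of_nonpos_of_nonpos (inv_lt_zero.2 hxy).le
      (not_lt.1 hcon)))

/-- A continuous function that crosses the level `c` only downwards stays below it. -/
theorem lt_of_forall_downcrossing {φ : ℝ → ℝ} {c a b : ℝ} (hφ : Continuous φ)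
    (hcross : ∀ x, φ x = c → (∀ᶠ y in 𝓝[>] x, φ y < c) ∧ ∀ᶠ y in 𝓝[<] x, c < φ y)
    (ha : φ a ≤ c) (hab : a < b) : φ b < c := by
  have hsub : Icc a b ⊆ {x | φ x ≤ c} := by
    refine IsClosed.Icc_subset_of_forall_mem_nhdsWithin
      ((isClosed_le hφ continuous_const).inter isClosed_Icc) ha fun x hx => ?_
    rcases (show φ x ≤ c from hx.1).lt_or_eq with h | h
    · have : ∀ᶠ y in 𝓝 x, φ y < c := hφ.continuousAt.eventually (gt_mem_nhds h)
      filter_upwards [this.filter_mono nhdsWithin_le_nhds] with y hy using hy.le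
    · filter_upwards [(hcross x h).1] with y hy using hy.le
  refine lt_of_le_of_ne (hsub (right_mem_Icc.2 hab.le)) fun h => ?_
  obtain ⟨y, hy, hay⟩ := ((hcross b h).2.and (Ioo_mem_nhdsLT hab)).exists
  exact absurd (hsub ⟨hay.1.le, hay.2.le⟩) (not_le.2 hy)

/-! ### Outward rays of a closed curve and winding numbers -/

/-- A closed curve `p` together with a nondecreasing direction angle `s` making one full turn,
such that the tangent of `p` always points to the left of the direction `exp (s θ * I)`. -/
structure OutwardDirected (p : ℝ → ℂ) (s : ℝ → ℝ) : Prop where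
  hasDerivAt : ∀ θ, ∃ v, HasDerivAt p v θ ∧ 0 < (v * exp (-(s θ * I))).im
  periodic : ∀ θ, p (θ + 2 * π) = p θ
  continuous_angle : Continuous s
  monotone_angle : Monotone s
  angle_add : ∀ θ, s (θ + 2 * π) = s θ + 2 * π

/-- `β` is a continuous argument of `q - p`, and `p` winds `n` times around `q`. -/
structure IsArgLift (p : ℝ → ℂ) (q : ℂ) (n : ℕ) (β : ℝ → ℝ) : Prop where
  continuous : Continuous β
  eq_exp : ∀ θ, ∃ ρ : ℝ, 0 < ρ ∧ q - p θ = ρ * exp (β θ * I)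
  add_period : ∀ θ, β (θ + 2 * π) = β θ + 2 * π * n

namespace OutwardDirected

variable {p : ℝ → ℂ} {s : ℝ → ℝ}

theorem continuous (hp : OutwardDirected p s) : Continuous p :=
  continuous_iff_continuousAt.2 fun θ => (hp.hasDerivAt θ).choose_spec.1.continuousAt

/-- In the frame turned by `-s θ`, `q - p` is real at `θ`, and its imaginary part has negative
derivative because the tangent points left. -/
theorem eventually_im (hp : OutwardDirected p s) {q : ℂ} {θ t : ℝ}
    (hq : q = p θ + t * exp (s θ * I)) :
    (∀ᶠ y in 𝓝[>] θ, ((q - p y) * exp (-(s θ * I))).im < 0) ∧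
      ∀ᶠ y in 𝓝[<] θ, 0 < ((q - p y) * exp (-(s θ * I))).im := by
  obtain ⟨v, hv, hpos⟩ := hp.hasDerivAt θ
  have h1 : HasDerivAt (fun y => (q - p y) * exp (-(s θ * I))) (-v * exp (-(s θ * I))) θ :=
    (hv.const_sub q).mul_const _
  have h2 := (imCLM.hasFDerivAt.comp_hasDerivAt θ h1)
  refine HasDerivAt.eventually_sign_of_neg h2 ?_ ?_
  · have : (q - p θ) * exp (-(s θ * I)) = (t : ℂ) := by
      rw [hq, add_sub_cancel_left, mul_assoc, ← Complex.exp_add, add_neg_cancel, Complex.exp_zero,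
        mul_one]
    simp [this]
  · have : imCLM (-v * exp (-(s θ * I))) = -(v * exp (-(s θ * I))).im := by
      rw [neg_mul]; exact neg_im _
    rw [this]
    exact neg_neg_of_pos hpos

theorem ray_iff {q : ℂ} {n : ℕ} {β : ℝ → ℝ} (hβ : IsArgLift p q n β)
    {θ : ℝ} : (∃ t : ℝ, 0 < t ∧ q = p θ + t * exp (s θ * I)) ↔
      ∃ m : ℤ, β θ - s θ = m * (2 * π) := by
  obtain ⟨ρ, hρ, h⟩ := hβ.eq_exp θ
  constructor
  · rintro ⟨t, ht, hq⟩
    have h3 : (t : ℂ) * exp (s θ * I) = ρ * exp (β θ * I) := by rw [← h, hq]; ring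
    have h4 : t = ρ := by
      have := congrArg norm h3
      simpa [norm_exp_ofReal_mul_I, abs_of_pos ht, abs_of_pos hρ] using this
    rw [h4] at h3
    have h5 := mul_left_cancel₀ (by exact_mod_cast hρ.ne') h3
    obtain ⟨m, hm⟩ := Complex.exp_eq_exp_iff_exists_int.1 h5.symm
    refine ⟨m, ?_⟩
    have := congrArg im hm
    simp at this
    linarith
  · rintro ⟨m, hm⟩
    refine ⟨ρ, hρ, ?_⟩
    have : exp (β θ * I) = exp (s θ * I) := by
      rw [Complex.exp_eq_exp_iff_exists_int]
      refine ⟨m, ?_⟩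
      have : β θ = s θ + m * (2 * π) := by linarith
      rw [this]; push_cast; ring
    rw [← this, ← h]; ring

/-- To the right of `θ` the argument of `q - p` falls below the fixed direction `s θ`, while `s` can
only rise, so `β - s` falls too. The left side is symmetric. -/
theorem downcrossing (hp : OutwardDirected p s) {q : ℂ} {n : ℕ} {β : ℝ → ℝ}
    (hβ : IsArgLift p q n β) (m : ℤ) (θ : ℝ) (h : β θ - s θ = m * (2 * π)) :
    (∀ᶠ y in 𝓝[>] θ, β y - s y < m * (2 * π)) ∧
      ∀ᶠ y in 𝓝[<] θ, m * (2 * π) < β y - s y := by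
  obtain ⟨t, ht, hq⟩ := (ray_iff (s := s) hβ).2 ⟨m, h⟩
  obtain ⟨h1, h2⟩ := hp.eventually_im hq
  have him : ∀ y, ∃ ρ : ℝ, 0 < ρ ∧ ((q - p y) * exp (-(s θ * I))).im
      = ρ * Real.sin (β y - s θ - m * (2 * π)) := by
    intro y
    obtain ⟨ρ, hρ, hy⟩ := hβ.eq_exp y
    refine ⟨ρ, hρ, ?_⟩
    rw [hy, mul_assoc, ← Complex.exp_add, Real.sin_sub_int_mul_two_pi,
      show (β y * I + -(s θ * I) : ℂ) = ((β y - s θ : ℝ) : ℂ) * I by push_cast; ring,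
      im_ofReal_mul, exp_ofReal_mul_I_im]
  -- Within `π` of zero, the sign of the sine decides the sign of the angle.
  have hc : ∀ᶠ y in 𝓝 θ, |β y - s θ - m * (2 * π)| < π := by
    have : Filter.Tendsto (fun y => |β y - s θ - m * (2 * π)|) (𝓝 θ)
        (𝓝 |β θ - s θ - m * (2 * π)|) := by
      have := hβ.continuous
      exact (by fun_prop : Continuous fun y => |β y - s θ - m * (2 * π)|).continuousAt
    rw [h, sub_self, abs_zero] at this
    exact this.eventually (gt_mem_nhds Real.pi_pos)
  constructor
  · filter_upwards [h1, hc.filter_mono nhdsWithin_le_nhds, self_mem_nhdsWithin] with y hy hy' hyθ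
    obtain ⟨ρ, hρ, he⟩ := him y
    have hs := hp.monotone_angle (le_of_lt hyθ)
    rw [abs_lt] at hy'
    by_contra hcon
    have := Real.sin_nonneg_of_nonneg_of_le_pi (x := β y - s θ - m * (2 * π)) (by linarith)
      hy'.2.le
    rw [he] at hy
    exact absurd hy (not_lt.2 (mul_nonneg hρ.le this))
  · filter_upwards [h2, hc.filter_mono nhdsWithin_le_nhds, self_mem_nhdsWithin] with y hy hy' hyθ
    obtain ⟨ρ, hρ, he⟩ := him y
    have hs := hp.monotone_angle (le_of_lt hyθ)
    rw [abs_lt] at hy'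
    by_contra hcon
    have := Real.sin_nonpos_of_nonpos_of_neg_pi_le (x := β y - s θ - m * (2 * π)) (by linarith)
      hy'.1.le
    rw [he] at hy
    exact absurd hy (not_lt.2 (mul_nonpos_of_nonneg_of_nonpos hρ.le this))

theorem sub_add_period (hp : OutwardDirected p s) {q : ℂ} {n : ℕ} {β : ℝ → ℝ}
    (hβ : IsArgLift p q n β) (θ : ℝ) (k : ℕ) :
    β (θ + k * (2 * π)) - s (θ + k * (2 * π)) = β θ - s θ + (n - 1) * k * (2 * π) := by
  induction k with
  | zero => simp
  | succ k ih =>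
    have : θ + ((k + 1 : ℕ) : ℝ) * (2 * π) = θ + k * (2 * π) + 2 * π := by push_cast; ring
    rw [this, hβ.add_period, hp.angle_add]
    push_cast
    linarith

/-- Over one turn `β - s` changes by `2π(n - 1)`, at least `2π` in absolute value, so it passes a
multiple of `2π`. -/
theorem exists_eq_int_mul (hp : OutwardDirected p s) {q : ℂ} {n : ℕ} {β : ℝ → ℝ}
    (hβ : IsArgLift p q n β) (hn : n ≠ 1) : ∃ θ, ∃ m : ℤ, β θ - s θ = m * (2 * π) := by
  have hc : Continuous fun θ => β θ - s θ := hβ.continuous.sub hp.continuous_angle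
  have hπ := Real.two_pi_pos
  have h1 := hp.sub_add_period hβ 0 1
  rw [Nat.cast_one, zero_add, one_mul, mul_one] at h1
  have hle := Int.floor_le ((β 0 - s 0) / (2 * π))
  have hlt := Int.lt_floor_add_one ((β 0 - s 0) / (2 * π))
  rw [le_div_iff₀ hπ] at hle
  rw [div_lt_iff₀ hπ] at hlt
  rcases Nat.lt_or_ge n 1 with h | h
  · obtain rfl : n = 0 := by omega
    have := intermediate_value_Icc' hπ.le hc.continuousOn
    obtain ⟨θ, -, hθ⟩ := this (show (⌊(β 0 - s 0) / (2 * π)⌋ : ℝ) * (2 * π) ∈ _ from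
      ⟨by simp only [Nat.cast_zero] at h1; linarith, hle⟩)
    exact ⟨θ, _, hθ⟩
  · have hn2 : (2 : ℝ) ≤ n := by exact_mod_cast (show 2 ≤ n by omega)
    have := intermediate_value_Icc hπ.le hc.continuousOn
    obtain ⟨θ, -, hθ⟩ := this (show ((⌊(β 0 - s 0) / (2 * π)⌋ : ℝ) + 1) * (2 * π) ∈ _ from
      ⟨hlt.le, by nlinarith⟩)
    exact ⟨θ, ⌊(β 0 - s 0) / (2 * π)⌋ + 1, by push_cast; exact hθ⟩

/-- One turn later `β - s` is strictly below the level, so the change `2π(n - 1)` is negative. -/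
theorem winding_eq_zero_of_eq (hp : OutwardDirected p s) {q : ℂ} {n : ℕ} {β : ℝ → ℝ}
    (hβ : IsArgLift p q n β) {θ : ℝ} {m : ℤ} (h : β θ - s θ = m * (2 * π)) : n = 0 := by
  by_contra hn
  have hn : (1 : ℝ) ≤ n := by exact_mod_cast Nat.one_le_iff_ne_zero.2 hn
  have h1 := lt_of_forall_downcrossing (hβ.continuous.sub hp.continuous_angle)
    (hp.downcrossing hβ m) h.le (lt_add_of_pos_right θ Real.two_pi_pos)
  have h2 := hp.sub_add_period hβ θ 1
  simp only [Nat.cast_one, one_mul, mul_one] at h2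
  rw [Pi.sub_apply] at h1
  nlinarith [Real.two_pi_pos]

/-- The winding number about any point off the curve is `0` or `1`. -/
theorem winding_le_one (hp : OutwardDirected p s) {q : ℂ} {n : ℕ} {β : ℝ → ℝ}
    (hβ : IsArgLift p q n β) : n ≤ 1 := by
  by_contra hn
  obtain ⟨θ, m, h⟩ := hp.exists_eq_int_mul hβ (by omega)
  have := hp.winding_eq_zero_of_eq hβ h
  omega

/-- A point on one of the outward rays has winding number `0`. -/
theorem winding_eq_zero (hp : OutwardDirected p s) {q : ℂ} {n : ℕ} {β : ℝ → ℝ}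
    (hβ : IsArgLift p q n β) {θ t : ℝ} (ht : 0 < t) (hq : q = p θ + t * exp (s θ * I)) : n = 0 := by
  obtain ⟨m, hm⟩ := (ray_iff (s := s) hβ).1 ⟨t, ht, hq⟩
  exact hp.winding_eq_zero_of_eq hβ hm

/-- A point with winding number `0` lies on an outward ray. -/
theorem exists_ray (hp : OutwardDirected p s) {q : ℂ} {β : ℝ → ℝ}
    (hβ : IsArgLift p q 0 β) : ∃ θ t : ℝ, 0 < t ∧ q = p θ + t * exp (s θ * I) := by
  obtain ⟨θ, h⟩ := hp.exists_eq_int_mul hβ zero_ne_one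
  exact ⟨θ, (ray_iff hβ).2 h⟩

/-- All outward rays through a point off the curve have the same direction. -/
theorem ray_unique (hp : OutwardDirected p s) {q : ℂ} {n : ℕ} {β : ℝ → ℝ}
    (hβ : IsArgLift p q n β) {θ₁ t₁ θ₂ t₂ : ℝ} (ht₁ : 0 < t₁)
    (hq₁ : q = p θ₁ + t₁ * exp (s θ₁ * I)) (ht₂ : 0 < t₂)
    (hq₂ : q = p θ₂ + t₂ * exp (s θ₂ * I)) : exp (s θ₁ * I) = exp (s θ₂ * I) := by
  obtain rfl := hp.winding_eq_zero hβ ht₁ hq₁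
  obtain ⟨m₁, h₁⟩ := (ray_iff (s := s) hβ).1 ⟨t₁, ht₁, hq₁⟩
  obtain ⟨m₂, h₂⟩ := (ray_iff (s := s) hβ).1 ⟨t₂, ht₂, hq₂⟩
  wlog hm : m₁ ≤ m₂ generalizing m₁ m₂ θ₁ θ₂ t₁ t₂
  · exact (this ht₂ hq₂ ht₁ hq₁ m₂ h₂ m₁ h₁ (by omega)).symm
  -- With `n = 0`, moving `θ₂` on by `k` turns lowers `β - s` to the level `m₁`, which can be
  -- attained only once.
  obtain ⟨k, rfl⟩ := Int.le.dest hm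
  have h3 := hp.sub_add_period hβ θ₂ k
  have h4 : β (θ₂ + k * (2 * π)) - s (θ₂ + k * (2 * π)) = m₁ * (2 * π) := by
    rw [h3, h₂]; push_cast; ring
  have hθ : θ₁ = θ₂ + k * (2 * π) := by
    have hc : Continuous fun θ => β θ - s θ := hβ.continuous.sub hp.continuous_angle
    rcases lt_trichotomy θ₁ (θ₂ + k * (2 * π)) with h | h | h
    · exact absurd h4 (lt_of_forall_downcrossing hc (hp.downcrossing hβ m₁) h₁.le h).ne
    · exact h
    · exact absurd h₁ (lt_of_forall_downcrossing hc (hp.downcrossing hβ m₁) h4.le h).ne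
  have hs : s θ₁ = s θ₂ + k * (2 * π) := by
    rw [hθ]
    clear h3 h4 hθ hm h₂
    induction k with
    | zero => simp
    | succ k ih =>
      rw [show θ₂ + ((k + 1 : ℕ) : ℝ) * (2 * π) = θ₂ + k * (2 * π) + 2 * π by push_cast; ring,
        hp.angle_add, ih]
      push_cast; ring
  rw [Complex.exp_eq_exp_iff_exists_int]
  exact ⟨k, by rw [hs]; push_cast; ring⟩

/-- Points near a point of an outward ray lie on outward rays. -/
theorem eventually_exists_ray (hp : OutwardDirected p s) {q : ℂ} {θ t : ℝ} (ht : 0 < t)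
    (hq : q = p θ + t * exp (s θ * I)) :
    ∀ᶠ q' in 𝓝 q, ∃ θ' t' : ℝ, 0 < t' ∧ q' = p θ' + t' * exp (s θ' * I) := by
  -- In the frame of the ray at `y`, `q'` lies on that ray when `w q' y` is real and positive. The
  -- imaginary part changes sign at `θ` for `q' = q`; the sign change survives for nearby `q'` and
  -- yields a zero.
  set w : ℂ → ℝ → ℂ := fun q' y => (q' - p y) * exp (-(s y * I)) with hw
  have hpc := hp.continuous
  have hsc := hp.continuous_angle
  have hwc : ∀ q', Continuous (w q') := fun q' => by simp only [hw]; fun_prop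
  have hwq : ∀ y, Continuous fun q' => w q' y := fun y => by simp only [hw]; fun_prop
  have hw0 : w q θ = t := by
    simp only [hw]
    rw [hq, add_sub_cancel_left, mul_assoc, ← Complex.exp_add, add_neg_cancel, Complex.exp_zero,
      mul_one]
  obtain ⟨h1, h2⟩ := hp.eventually_im hq
  have hre : ∀ᶠ y in 𝓝 θ, t / 2 < (w q y).re :=
    (continuous_re.comp (hwc q)).continuousAt.eventually
      (lt_mem_nhds (by simp [hw0]; linarith))
  have hsy : ∀ᶠ y in 𝓝 θ, |s y - s θ| < π / 2 := by
    have : Filter.Tendsto (fun y => |s y - s θ|) (𝓝 θ) (𝓝 |s θ - s θ|) :=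
      (by fun_prop : Continuous fun y => |s y - s θ|).continuousAt
    rw [sub_self, abs_zero] at this
    exact this.eventually (gt_mem_nhds (by positivity))
  -- Passage from the fixed frame `s θ` to the moving frame `s y`; monotonicity of `s` only
  -- reinforces the signs.
  have hrot : ∀ y, ((q - p y) * exp (-(s θ * I))).im
      = (w q y).im * Real.cos (s y - s θ) + (w q y).re * Real.sin (s y - s θ) := by
    intro y
    have : (q - p y) * exp (-(s θ * I)) = w q y * exp ((s y - s θ : ℝ) * I) := by
      simp only [hw]
      rw [mul_assoc, ← Complex.exp_add]
      congr 2; push_cast; ring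
    rw [this, mul_im, exp_ofReal_mul_I_re, exp_ofReal_mul_I_im]
    ring
  have hR : ∀ᶠ y in 𝓝[>] θ, (w q y).im < 0 := by
    filter_upwards [h1, hre.filter_mono nhdsWithin_le_nhds, hsy.filter_mono nhdsWithin_le_nhds,
      self_mem_nhdsWithin] with y h1 h2 h3 h4
    have hm := hp.monotone_angle (le_of_lt h4)
    rw [hrot] at h1
    rw [abs_lt] at h3
    have hcos := Real.cos_pos_of_mem_Ioo ⟨by linarith, h3.2⟩
    have hsin := Real.sin_nonneg_of_nonneg_of_le_pi (sub_nonneg.2 hm) (by linarith [Real.pi_pos])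
    by_contra hcon
    have a1 := mul_nonneg (not_lt.1 hcon) hcos.le
    have a2 := mul_nonneg (show 0 ≤ (w q y).re by linarith) hsin
    linarith
  have hL : ∀ᶠ y in 𝓝[<] θ, 0 < (w q y).im := by
    filter_upwards [h2, hre.filter_mono nhdsWithin_le_nhds, hsy.filter_mono nhdsWithin_le_nhds,
      self_mem_nhdsWithin] with y h1 h2 h3 h4
    have hm := hp.monotone_angle (le_of_lt h4)
    rw [hrot] at h1
    rw [abs_lt] at h3
    have hcos := Real.cos_pos_of_mem_Ioo ⟨h3.1, by linarith⟩
    have hsin := Real.sin_nonpos_of_nonpos_of_neg_pi_le (sub_nonpos.2 hm)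
      (by linarith [Real.pi_pos])
    by_contra hcon
    have a1 := mul_nonpos_of_nonpos_of_nonneg (not_lt.1 hcon) hcos.le
    have a2 := mul_nonpos_of_nonneg_of_nonpos (show 0 ≤ (w q y).re by linarith) hsin
    linarith
  obtain ⟨ε, hε, hball⟩ := Metric.eventually_nhds_iff.1 hre
  obtain ⟨b, hb, hθb⟩ := (hR.and (Ioo_mem_nhdsGT (lt_add_of_pos_right θ hε))).exists
  obtain ⟨a, ha, haθ⟩ := (hL.and (Ioo_mem_nhdsLT (sub_lt_self θ hε))).exists
  have e1 : ∀ᶠ q' in 𝓝 q, (w q' b).im < 0 :=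
    (continuous_im.comp (hwq b)).continuousAt.eventually (gt_mem_nhds hb)
  have e2 : ∀ᶠ q' in 𝓝 q, 0 < (w q' a).im :=
    (continuous_im.comp (hwq a)).continuousAt.eventually (lt_mem_nhds ha)
  filter_upwards [e1, e2, Metric.ball_mem_nhds q (half_pos ht)] with q' e1 e2 e3
  have hab : a ≤ b := (haθ.2.trans hθb.1).le
  obtain ⟨y, hy, hy0⟩ := intermediate_value_Icc' hab
    (continuous_im.comp (hwc q')).continuousOn ⟨e1.le, e2.le⟩
  have hyr : t / 2 < (w q y).re := hball (by
    rw [Real.dist_eq, abs_lt]; exact ⟨by linarith [hy.1, haθ.1], by linarith [hy.2, hθb.2]⟩)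
  have hdiff : ‖w q' y - w q y‖ < t / 2 := by
    simp only [hw]
    rw [← sub_mul, norm_mul, sub_sub_sub_cancel_right,
      show (-(s y * I) : ℂ) = ((-s y : ℝ) : ℂ) * I by push_cast; ring, norm_exp_ofReal_mul_I,
      mul_one]
    simpa [dist_eq_norm] using e3
  refine ⟨y, (w q' y).re, ?_, ?_⟩
  · have := (abs_re_le_norm (w q' y - w q y)).trans_lt hdiff
    rw [abs_lt, sub_re] at this
    linarith
  · have : ((w q' y).re : ℂ) = w q' y := Complex.ext (by simp) (by simpa using hy0.symm)
    rw [this]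
    simp only [hw]
    rw [mul_assoc, ← Complex.exp_add, neg_add_cancel, Complex.exp_zero, mul_one]
    ring

end OutwardDirected

/-! ### Positive zeros and a topological argument principle -/

/-- Near its zero `a` the function `u` stays relatively close to `z ↦ c * (z - a)`; in particular
the zero is isolated and has index `1`. -/
def IsPositiveZero (u : ℂ → ℂ) (a : ℂ) : Prop :=
  ∃ c : ℂ, c ≠ 0 ∧ ∃ k : ℝ, k < 1 ∧ ∀ᶠ z in 𝓝 a, ‖u z - c * (z - a)‖ ≤ k * ‖c‖ * ‖z - a‖

theorem IsPositiveZero.congr {u v : ℂ → ℂ} {a : ℂ} (hu : IsPositiveZero u a) (h : u =ᶠ[𝓝 a] v) :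
    IsPositiveZero v a := by
  obtain ⟨c, hc, k, hk, hev⟩ := hu
  refine ⟨c, hc, k, hk, ?_⟩
  filter_upwards [hev, h] with z hz hz'
  rwa [← hz']

/-- Near `a` the factor `(z - b)⁻¹` is almost constant; enlarging `k` slightly absorbs its
variation. This keeps the remaining zeros positive when one is divided out. -/
theorem IsPositiveZero.div_sub {u : ℂ → ℂ} {a b : ℂ} (hu : IsPositiveZero u a) (hab : a ≠ b) :
    IsPositiveZero (fun z => u z / (z - b)) a := by
  obtain ⟨c, hc, k, hk, hev⟩ := hu
  obtain ⟨k', hkk', hk'⟩ := exists_between hk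
  have hab' : a - b ≠ 0 := sub_ne_zero.2 hab
  refine ⟨c / (a - b), div_ne_zero hc hab', k', hk', ?_⟩
  have hlim : Filter.Tendsto (fun z => k * ‖(z - b)⁻¹‖ + ‖(z - b)⁻¹ - (a - b)⁻¹‖) (𝓝 a)
      (𝓝 (k * ‖(a - b)⁻¹‖ + ‖(a - b)⁻¹ - (a - b)⁻¹‖)) := by
    have h1 : Filter.Tendsto (fun z => (z - b)⁻¹) (𝓝 a) (𝓝 (a - b)⁻¹) :=
      ((continuous_id.sub continuous_const).tendsto a).inv₀ hab'
    exact (h1.norm.const_mul k).add (h1.sub_const _).norm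
  have hlt : k * ‖(a - b)⁻¹‖ + ‖(a - b)⁻¹ - (a - b)⁻¹‖ < k' * ‖(a - b)⁻¹‖ := by
    rw [sub_self, norm_zero, add_zero]
    exact mul_lt_mul_of_pos_right hkk' (norm_pos_iff.2 (inv_ne_zero hab'))
  filter_upwards [hev, hlim.eventually (gt_mem_nhds hlt)] with z hz hz'
  have e1 : u z / (z - b) - c / (a - b) * (z - a)
      = (u z - c * (z - a)) * (z - b)⁻¹ + c * (z - a) * ((z - b)⁻¹ - (a - b)⁻¹) := by
    simp only [div_eq_mul_inv]; ring
  rw [e1]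
  refine (norm_add_le _ _).trans ?_
  rw [norm_mul, norm_mul, norm_mul, norm_div, div_eq_mul_inv, ← norm_inv]
  calc ‖u z - c * (z - a)‖ * ‖(z - b)⁻¹‖ + ‖c‖ * ‖z - a‖ * ‖(z - b)⁻¹ - (a - b)⁻¹‖
      ≤ k * ‖c‖ * ‖z - a‖ * ‖(z - b)⁻¹‖ + ‖c‖ * ‖z - a‖ * ‖(z - b)⁻¹ - (a - b)⁻¹‖ := by gcongr
    _ = ‖c‖ * ‖z - a‖ * (k * ‖(z - b)⁻¹‖ + ‖(z - b)⁻¹ - (a - b)⁻¹‖) := by ring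
    _ ≤ ‖c‖ * ‖z - a‖ * (k' * ‖(a - b)⁻¹‖) := by gcongr
    _ = k' * (‖c‖ * ‖(a - b)⁻¹‖) * ‖z - a‖ := by ring

/-- A positive zero can be divided out, changing the quotient only close to the zero. -/
theorem IsPositiveZero.exists_div {u : ℂ → ℂ} {a : ℂ} (hu : Continuous u)
    (ha : IsPositiveZero u a) {W : Set ℂ} (hW : W ∈ 𝓝 a)
    (hne : ∀ z ∈ W, z ≠ a → u z ≠ 0) :
    ∃ v : ℂ → ℂ, Continuous v ∧ (∀ z ∈ W, v z ≠ 0) ∧ ∃ V : Set ℂ, IsClosed V ∧ a ∈ V ∧ V ⊆ W ∧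
      ∀ z ∉ V, v z = u z / (z - a) := by
  obtain ⟨c, hc, k, hk, hev⟩ := ha
  obtain ⟨ε, hε, hball⟩ := Metric.nhds_basis_closedBall.mem_iff.1 (Filter.inter_mem hev hW)
  have hmax : ∀ z : ℂ, (0 : ℝ) < max ‖z - a‖ ε := fun z => lt_max_of_lt_right hε
  have hmaxc : ∀ z : ℂ, ((max ‖z - a‖ ε : ℝ) : ℂ) ≠ 0 := fun z => by exact_mod_cast (hmax z).ne'
  have hconj : ∀ z : ℂ, (z - a) * conj (z - a) = (‖z - a‖ : ℂ) ^ 2 := fun z => Complex.mul_conj' _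
  -- For `‖z - a‖ ≥ ε` this is `u z / (z - a)`; inside, the correction has norm below `‖c‖`, so no
  -- zero is created.
  set v : ℂ → ℂ := fun z =>
    c + (u z - c * (z - a)) * conj (z - a) / ((max ‖z - a‖ ε : ℝ) : ℂ) ^ 2 with hv
  have hout : ∀ z, ε ≤ ‖z - a‖ → v z = u z / (z - a) := by
    intro z hz
    have hza : z - a ≠ 0 := norm_pos_iff.1 (hε.trans_le hz)
    have hza' : conj (z - a) ≠ 0 := (map_ne_zero _).2 hza
    simp only [hv, max_eq_left hz]
    rw [← hconj, mul_div_mul_right _ _ hza', sub_div, mul_div_cancel_right₀ _ hza]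
    ring
  refine ⟨v, ?_, ?_, closedBall a ε, isClosed_closedBall, mem_closedBall_self hε.le,
    fun z hz => (hball hz).2, ?_⟩
  · have : Continuous fun z : ℂ => ((max ‖z - a‖ ε : ℝ) : ℂ) ^ 2 := by fun_prop
    have hcj : Continuous fun z : ℂ => conj (z - a) :=
      continuous_conj.comp (continuous_id.sub continuous_const)
    exact continuous_const.add (Continuous.div (by fun_prop) this fun z => pow_ne_zero _ (hmaxc z))
  · intro z hzW h0
    rcases le_or_gt ε ‖z - a‖ with hz | hz
    · rw [hout z hz] at h0
      have hza : z - a ≠ 0 := norm_pos_iff.1 (hε.trans_le hz)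
      exact hne z hzW (sub_ne_zero.1 hza) ((div_eq_zero_iff.1 h0).resolve_right hza)
    · have hz' := (hball (show z ∈ closedBall a ε by
        rw [mem_closedBall, dist_eq_norm]; exact hz.le)).1
      have hz'' : ‖u z - c * (z - a)‖ ≤ k * ‖c‖ * ‖z - a‖ := hz'
      have hn : ‖(u z - c * (z - a)) * conj (z - a) / ((max ‖z - a‖ ε : ℝ) : ℂ) ^ 2‖ = ‖c‖ := by
        rw [← norm_neg c]; congr 1; simp only [hv] at h0; linear_combination h0
      have hcn : 0 < ‖c‖ := norm_pos_iff.2 hc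
      rw [max_eq_right hz.le, norm_div, norm_mul, RCLike.norm_conj, norm_pow, norm_real,
        Real.norm_of_nonneg hε.le, div_eq_iff (by positivity)] at hn
      have h1 : ‖u z - c * (z - a)‖ * ‖z - a‖ ≤ k * ‖c‖ * ‖z - a‖ * ‖z - a‖ := by gcongr
      have h2 : ‖z - a‖ * ‖z - a‖ < ε ^ 2 := by
        rw [sq]; exact mul_self_lt_mul_self (norm_nonneg _) hz
      have h3 : 0 ≤ ‖z - a‖ * ‖z - a‖ := by positivity
      have h4 : k * ‖c‖ * ‖z - a‖ * ‖z - a‖ < ‖c‖ * ε ^ 2 := by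
        calc k * ‖c‖ * ‖z - a‖ * ‖z - a‖ = ‖c‖ * (k * (‖z - a‖ * ‖z - a‖)) := by ring
          _ ≤ ‖c‖ * (1 * (‖z - a‖ * ‖z - a‖)) := by gcongr
          _ < ‖c‖ * ε ^ 2 := by rw [one_mul]; gcongr
      linarith
  · intro z hz
    rw [mem_closedBall, dist_eq_norm, not_le] at hz
    exact hout z hz.le

/-- The circle of radius `r > |a|` winds once around `a`. -/
theorem exists_arg_circle_sub {a : ℂ} {r : ℝ} (hr : 0 < r) (ha : ‖a‖ < r) :
    ∃ β : ℝ → ℝ, Continuous β ∧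
      (∀ θ : ℝ, ∃ ρ : ℝ, 0 < ρ ∧ r * exp (θ * I) - a = ρ * exp (β θ * I)) ∧
      ∀ θ, β (θ + 2 * π) = β θ + 2 * π := by
  -- `r e^{iθ} - a = r e^{iθ} w θ` with `|w θ - 1| < 1`, so the principal argument of `w` is
  -- continuous and periodic.
  set w : ℝ → ℂ := fun θ => 1 - a / r * exp ((-θ : ℝ) * I) with hw
  have hslit : ∀ θ, w θ ∈ slitPlane := by
    intro θ
    refine mem_slitPlane_of_norm_lt_one (z := -(a / r * exp ((-θ : ℝ) * I))) ?_
    rw [norm_neg, norm_mul, norm_exp_ofReal_mul_I, mul_one, norm_div, norm_real,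
      Real.norm_of_nonneg hr.le]
    exact (div_lt_one hr).2 ha
  have hrc : (r : ℂ) ≠ 0 := by exact_mod_cast hr.ne'
  refine ⟨fun θ => θ + (w θ).arg, ?_, ?_, ?_⟩
  · have hwc : Continuous w := by simp only [hw]; fun_prop
    exact continuous_id.add (continuous_iff_continuousAt.2 fun θ =>
      (continuousAt_arg (hslit θ)).comp hwc.continuousAt)
  · intro θ
    have hne : w θ ≠ 0 := slitPlane_ne_zero (hslit θ)
    refine ⟨r * ‖w θ‖, mul_pos hr (norm_pos_iff.2 hne), ?_⟩
    have h1 : (r : ℂ) * exp (θ * I) - a = r * exp (θ * I) * w θ := by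
      simp only [hw]
      have : exp (θ * I) * exp ((-θ : ℝ) * I) = 1 := by
        rw [← Complex.exp_add]; push_cast; simp
      have h2 : (r : ℂ) * (a / r) = a := by field_simp
      linear_combination a * this + exp (θ * I) * exp ((-θ : ℝ) * I) * h2
    rw [h1]
    conv_lhs => rw [← norm_mul_exp_arg_mul_I (w θ)]
    push_cast
    rw [add_mul, Complex.exp_add]
    ring
  · intro θ
    have : w (θ + 2 * π) = w θ := by
      simp only [hw]
      congr 2
      rw [Complex.exp_eq_exp_iff_exists_int]
      exact ⟨-1, by push_cast; ring⟩
    simp only [this]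
    ring

/-- The argument principle for continuous functions with positive zeros. -/
theorem exists_arg_lift_card_zeros {r : ℝ} (hr : 0 < r) (Z : Finset ℂ) :
    ∀ u : ℂ → ℂ, Continuous u → (∀ z, u z = 0 ↔ z ∈ Z) → (∀ z ∈ Z, ‖z‖ < r) →
      (∀ z ∈ Z, IsPositiveZero u z) →
      ∃ β : ℝ → ℝ, Continuous β ∧
        (∀ θ : ℝ, ∃ ρ : ℝ, 0 < ρ ∧ u (r * exp (θ * I)) = ρ * exp (β θ * I)) ∧
        ∀ θ, β (θ + 2 * π) = β θ + 2 * π * Z.card := by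
  induction Z using Finset.induction_on with
  | empty =>
    intro u hu h0 _ _
    have hne : ∀ z, u z ≠ 0 := fun z hz => by simpa using (h0 z).1 hz
    -- Without zeros, `u` has a logarithm on the whole plane, so its argument returns to its value
    -- along the circle.
    obtain ⟨L, ⟨-, hexp⟩, -⟩ := isCoveringMapOn_exp.existsUnique_continuousMap_lifts
      (⟨u, hu⟩ : C(ℂ, ℂ)) (a₀ := 0) (exp_log (hne 0)) (fun z => hne z)
    have hexp : ∀ z, exp (L z) = u z := fun z => congrFun hexp z
    have hL : Continuous L := L.continuous
    refine ⟨fun θ => (L (r * exp (θ * I))).im, by fun_prop, fun θ => ?_, fun θ => ?_⟩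
    · refine ⟨Real.exp (L (r * exp (θ * I))).re, Real.exp_pos _, ?_⟩
      rw [← hexp]
      conv_lhs => rw [← re_add_im (L (r * exp (θ * I)))]
      rw [Complex.exp_add, ofReal_exp]
    · have : exp (((θ + 2 * π : ℝ) : ℂ) * I) = exp (θ * I) := by
        rw [Complex.exp_eq_exp_iff_exists_int]
        exact ⟨1, by push_cast; ring⟩
      simp only [this, Finset.card_empty, Nat.cast_zero, mul_zero, add_zero]
  | insert a Z haZ ih =>
    intro u hu h0 hZr hpos
    have hW : ((Z : Set ℂ)ᶜ) ∈ 𝓝 a := Z.finite_toSet.isClosed.isOpen_compl.mem_nhds (by simpa)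
    have hWr := Filter.inter_mem hW (isOpen_ball.mem_nhds
      (show a ∈ ball (0 : ℂ) r by simpa using hZr a (by simp)))
    obtain ⟨v, hv, hvW, V, hVc, haV, hVW, hvV⟩ := (hpos a (by simp)).exists_div hu hWr
      (fun z hz hza h => by
        rcases Finset.mem_insert.1 ((h0 z).1 h) with h | h
        · exact hza h
        · exact hz.1 h)
    have hv0 : ∀ z, v z = 0 ↔ z ∈ Z := by
      intro z
      by_cases hz : z ∈ V
      · have h1 := hVW hz
        exact ⟨fun h => absurd h (hvW z h1), fun h => absurd h h1.1⟩
      · have hza : z ≠ a := fun h => hz (h ▸ haV)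
        rw [hvV z hz, div_eq_zero_iff, h0, Finset.mem_insert, sub_eq_zero]
        tauto
    obtain ⟨β, hβ, hβe, hβp⟩ := ih v hv hv0 (fun z hz => hZr z (by simp [hz])) (fun z hz => by
      have hzV : z ∉ V := fun h => (hVW h).1 hz
      have hza : z ≠ a := fun h => haZ (h ▸ hz)
      refine ((hpos z (by simp [hz])).div_sub hza).congr ?_
      filter_upwards [hVc.isOpen_compl.mem_nhds hzV] with y hy
      exact (hvV y hy).symm)
    obtain ⟨γ, hγ, hγe, hγp⟩ := exists_arg_circle_sub hr (hZr a (by simp))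
    refine ⟨fun θ => β θ + γ θ, hβ.add hγ, fun θ => ?_, fun θ => ?_⟩
    · obtain ⟨ρ₁, h1, e1⟩ := hβe θ
      obtain ⟨ρ₂, h2, e2⟩ := hγe θ
      refine ⟨ρ₁ * ρ₂, mul_pos h1 h2, ?_⟩
      have hnV : (r * exp (θ * I) : ℂ) ∉ V := fun h => by
        have := (hVW h).2
        rw [mem_ball_zero_iff, norm_mul, norm_exp_ofReal_mul_I, norm_real,
          Real.norm_of_nonneg hr.le, mul_one] at this
        exact lt_irrefl _ this
      have hza : (r * exp (θ * I) : ℂ) - a ≠ 0 := sub_ne_zero.2 fun h => hnV (h ▸ haV)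
      rw [hvV _ hnV, div_eq_iff hza, e2] at e1
      rw [e1]
      push_cast
      rw [add_mul, Complex.exp_add]
      ring
    · simp only [hβp, hγp, Finset.card_insert_of_notMem haZ]
      push_cast
      ring

/-! ### Injectivity and exterior ray fields -/

/-- A sense-preserving local homeomorphism of the disk, such that the images of all circles about
`0` admit a nondecreasing system of outward directions. -/
structure HasOutwardCircles (f : ℂ → ℂ) : Prop where
  map_nhds : ∀ a ∈ ball (0 : ℂ) 1, Filter.map f (𝓝 a) = 𝓝 (f a)
  positive : ∀ a ∈ ball (0 : ℂ) 1, IsPositiveZero (fun z => f z - f a) a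
  directed : ∀ r : ℝ, 0 < r → r < 1 → ∃ s, OutwardDirected (fun θ : ℝ => f (r * exp (θ * I))) s

theorem IsPositiveZero.eventually_ne {u : ℂ → ℂ} {a : ℂ} (hu : IsPositiveZero u a) :
    ∀ᶠ z in 𝓝[≠] a, u z ≠ 0 := by
  obtain ⟨c, hc, k, hk, hev⟩ := hu
  filter_upwards [hev.filter_mono nhdsWithin_le_nhds, self_mem_nhdsWithin] with z hz hza h0
  have hza : 0 < ‖z - a‖ := norm_pos_iff.2 (sub_ne_zero.2 hza)
  rw [h0, zero_sub, norm_neg, norm_mul, mul_assoc] at hz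
  have : 0 < ‖c‖ * ‖z - a‖ := mul_pos (norm_pos_iff.2 hc) hza
  nlinarith

namespace HasOutwardCircles

variable {f : ℂ → ℂ}

theorem continuousAt (hf : HasOutwardCircles f) {a : ℂ} (ha : a ∈ ball (0 : ℂ) 1) :
    ContinuousAt f a := (hf.map_nhds a ha).le

theorem finite_fiber (hf : HasOutwardCircles f) {r : ℝ} (hr1 : r < 1) (q : ℂ) :
    {z ∈ closedBall (0 : ℂ) r | f z = q}.Finite := by
  by_contra hinf
  obtain ⟨a, ha, hacc⟩ := Set.Infinite.exists_accPt_of_subset_isCompact hinf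
    (isCompact_closedBall (0 : ℂ) r) (fun z hz => hz.1)
  have ha1 : a ∈ ball (0 : ℂ) 1 := closedBall_subset_ball hr1 ha
  have hfr := accPt_iff_frequently_nhdsNE.1 hacc
  have hfa : f a = q := by
    by_contra hne
    have := (hf.continuousAt ha1).eventually (isOpen_ne.mem_nhds hne)
    obtain ⟨z, hz1, hz2⟩ := (hfr.and_eventually (this.filter_mono nhdsWithin_le_nhds)).exists
    exact hz2 hz1.2
  obtain ⟨z, hz1, hz2⟩ := (hfr.and_eventually (hf.positive a ha1).eventually_ne).exists
  exact hz2 (by rw [hz1.2, hfa, sub_self])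

/-- Supplies the link between the two halves of the argument: the winding number is the number of
preimages in the disk. -/
theorem exists_isArgLift (hf : HasOutwardCircles f) {r : ℝ} (hr : 0 < r) (hr1 : r < 1) {q : ℂ}
    (hq : q ∉ f '' sphere 0 r) :
    ∃ (Z : Finset ℂ) (β : ℝ → ℝ), (∀ z, z ∈ Z ↔ z ∈ closedBall 0 r ∧ f z = q) ∧
      IsArgLift (fun θ : ℝ => f (r * exp (θ * I))) q Z.card β := by
  have hfin := hf.finite_fiber hr1 q
  set Z := hfin.toFinset with hZ
  have hmem : ∀ z, z ∈ Z ↔ z ∈ closedBall 0 r ∧ f z = q := fun z => by simp [hZ]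
  -- The radial retraction onto the closed disk extends `f - q` continuously to the plane without
  -- adding zeros.
  set ret : ℂ → ℂ := fun z => ((r / max ‖z‖ r : ℝ) : ℂ) * z with hret
  have hmax : ∀ z : ℂ, 0 < max ‖z‖ r := fun z => lt_max_of_lt_right hr
  have hretc : Continuous ret := by
    have : Continuous fun z : ℂ => r / max ‖z‖ r :=
      continuous_const.div (by fun_prop) fun z => (hmax z).ne'
    exact (continuous_ofReal.comp this).mul continuous_id
  have hret_in : ∀ z, ‖z‖ ≤ r → ret z = z := fun z hz => by
    simp only [hret, max_eq_right hz, div_self hr.ne', ofReal_one, one_mul]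
  have hret_out : ∀ z, r ≤ ‖z‖ → ‖ret z‖ = r := fun z hz => by
    have : 0 < ‖z‖ := hr.trans_le hz
    simp only [hret, max_eq_left hz]
    rw [norm_mul, norm_real, Real.norm_of_nonneg (by positivity), div_mul_cancel₀ _ this.ne']
  have hret_le : ∀ z, ‖ret z‖ ≤ r := fun z => by
    rcases le_total ‖z‖ r with h | h
    · rwa [hret_in z h]
    · exact (hret_out z h).le
  have hlt : ∀ z ∈ Z, ‖z‖ < r := fun z hz => by
    obtain ⟨h1, h2⟩ := (hmem z).1 hz
    refine lt_of_le_of_ne (by simpa using h1) fun h => hq ⟨z, by simpa using h, h2⟩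
  have hu : Continuous fun z => f (ret z) - q := by
    refine continuous_iff_continuousAt.2 fun z => ?_
    have h1 : ret z ∈ ball (0 : ℂ) 1 := by simpa using (hret_le z).trans_lt hr1
    exact ((hf.continuousAt h1).comp hretc.continuousAt).sub continuousAt_const
  have hu0 : ∀ z, f (ret z) - q = 0 ↔ z ∈ Z := by
    intro z
    rw [sub_eq_zero, hmem]
    rcases le_or_gt ‖z‖ r with h | h
    · rw [hret_in z h]
      exact ⟨fun h' => ⟨by simpa using h, h'⟩, fun h' => h'.2⟩
    · refine ⟨fun h' => absurd ⟨ret z, by simpa using hret_out z h.le, h'⟩ hq, fun h' => ?_⟩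
      exact absurd h'.1 (by simpa using h)
  have hupos : ∀ z ∈ Z, IsPositiveZero (fun z => f (ret z) - q) z := by
    intro z hz
    have h1 := hlt z hz
    obtain ⟨-, h2⟩ := (hmem z).1 hz
    refine (hf.positive z (by simpa using h1.trans hr1)).congr ?_
    have : ∀ᶠ y in 𝓝 z, ‖y‖ < r := continuous_norm.continuousAt.eventually (gt_mem_nhds h1)
    filter_upwards [this] with y hy
    rw [hret_in y hy.le, h2]
  obtain ⟨β, hβ, hβe, hβp⟩ := exists_arg_lift_card_zeros hr Z 
    (fun z => f (ret z) - q) hu hu0 hlt hupos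
  -- The shift by `π` passes from `f - q` to `q - f`.
  refine ⟨Z, fun θ => β θ + π, hmem, by fun_prop, fun θ => ?_, fun θ => ?_⟩
  · obtain ⟨ρ, hρ, h⟩ := hβe θ
    refine ⟨ρ, hρ, ?_⟩
    have hn : ‖(r * exp (θ * I) : ℂ)‖ = r := by
      rw [norm_mul, norm_exp_ofReal_mul_I, norm_real, Real.norm_of_nonneg hr.le, mul_one]
    rw [hret_in _ hn.le] at h
    rw [ofReal_add, add_mul, Complex.exp_add, exp_pi_mul_I]
    linear_combination -h
  · simp only [hβp]; ring

theorem injOn (hf : HasOutwardCircles f) : InjOn f (ball 0 1) := by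
  intro z₁ h₁ z₂ h₂ heq
  by_contra hne
  rw [mem_ball_zero_iff] at h₁ h₂
  obtain ⟨R, hR, hR1⟩ := exists_between (max_lt h₁ h₂)
  have hfin := (hf.finite_fiber hR1 (f z₁)).image norm
  -- All but finitely many circles avoid the fibre of `f z₁`.
  obtain ⟨r, ⟨hr, hrR⟩, hrZ⟩ := ((Ioo_infinite hR).sdiff hfin).nonempty
  have hr0 : 0 < r := (norm_nonneg z₁).trans_lt ((le_max_left _ _).trans_lt hr)
  obtain ⟨s, hs⟩ := hf.directed r hr0 (hrR.trans hR1)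
  obtain ⟨Z, β, hZ, hβ⟩ := hf.exists_isArgLift hr0 (hrR.trans hR1) (q := f z₁) (by
    rintro ⟨z, hz, hfz⟩
    rw [mem_sphere_zero_iff_norm] at hz
    exact hrZ ⟨z, ⟨by simpa using hz.le.trans hrR.le, hfz⟩, hz⟩)
  have hcard := hs.winding_le_one hβ
  refine hne (Finset.card_le_one.1 hcard z₁ ((hZ _).2 ⟨?_, rfl⟩) z₂ ((hZ _).2 ⟨?_, heq.symm⟩))
  · simpa using ((le_max_left _ _).trans_lt hr).le
  · simpa using ((le_max_right _ _).trans_lt hr).le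

/-- The ray might return to the curve itself, where winding numbers are undefined. Since nearby
points also lie on outward rays, one may move to an interior `z'`: then `f z'` is off the curve by
injectivity, with winding number `0` but a preimage. -/
theorem ray_notMem (hf : HasOutwardCircles f) {r : ℝ} (hr : 0 < r) (hr1 : r < 1) {s : ℝ → ℝ}
    (hs : OutwardDirected (fun θ : ℝ => f (r * exp (θ * I))) s) {q : ℂ} {θ t : ℝ} (ht : 0 < t)
    (hq : q = f (r * exp (θ * I)) + t * exp (s θ * I)) : q ∉ f '' closedBall 0 r := by
  rintro ⟨z, hz, rfl⟩
  have hz1 : z ∈ ball (0 : ℂ) 1 := closedBall_subset_ball hr1 hz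
  have hev := (hf.continuousAt hz1).eventually (hs.eventually_exists_ray ht hq)
  have hcl : z ∈ closure (ball (0 : ℂ) r) := by rwa [closure_ball _ hr.ne']
  obtain ⟨z', hz', θ', t', ht', hq'⟩ :=
    ((mem_closure_iff_frequently.1 hcl).and_eventually hev).exists
  have hz'1 : z' ∈ ball (0 : ℂ) 1 := ball_subset_ball hr1.le hz'
  obtain ⟨Z, β, hZ, hβ⟩ := hf.exists_isArgLift hr hr1 (q := f z') (by
    rintro ⟨y, hy, hfy⟩
    rw [hf.injOn (sphere_subset_closedBall.trans (closedBall_subset_ball hr1) hy) hz'1 hfy] at hy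
    simp only [mem_sphere, mem_ball] at hy hz'
    exact hz'.ne hy)
  have h0 := hs.winding_eq_zero hβ ht' hq'
  rw [Finset.card_eq_zero] at h0
  have := (hZ z').2 ⟨ball_subset_closedBall hz', rfl⟩
  simp [h0] at this

/-- The complement of the image of a closed disk carries a field of noncrossing rays. -/
theorem exists_directions (hf : HasOutwardCircles f) {r : ℝ} (hr : 0 < r) (hr1 : r < 1) :
    ∃ D : ℂ → ℂ, (∀ q ∉ f '' closedBall 0 r, ‖D q‖ = 1 ∧
        ∀ t : ℝ, 0 ≤ t → q + t * D q ∉ f '' closedBall 0 r) ∧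
      ∀ q ∉ f '' closedBall 0 r, ∀ q' ∉ f '' closedBall 0 r, ∀ t t' : ℝ, 0 ≤ t → 0 ≤ t' →
        q + t * D q = q' + t' * D q' → D q = D q' := by
  obtain ⟨s, hs⟩ := hf.directed r hr hr1
  have key : ∀ q, ∃ d, q ∉ f '' closedBall 0 r →
      ∃ θ t : ℝ, 0 < t ∧ q = f (r * exp (θ * I)) + t * exp (s θ * I) ∧ d = exp (s θ * I) := by
    intro q
    by_cases hq : q ∈ f '' closedBall 0 r
    · exact ⟨0, fun h => absurd hq h⟩
    · obtain ⟨Z, β, hZ, hβ⟩ := hf.exists_isArgLift hr hr1 (q := q)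
        (fun h => hq (image_mono sphere_subset_closedBall h))
      have hcard : Z.card = 0 := by
        rw [Finset.card_eq_zero, Finset.eq_empty_iff_forall_notMem]
        exact fun z hz => hq ⟨z, ((hZ z).1 hz).1, ((hZ z).1 hz).2⟩
      rw [hcard] at hβ
      obtain ⟨θ, t, ht, h⟩ := hs.exists_ray hβ
      exact ⟨_, fun _ => ⟨θ, t, ht, h, rfl⟩⟩
  choose D hD using key
  have hray : ∀ q ∉ f '' closedBall 0 r, ∃ θ : ℝ, D q = exp (s θ * I) ∧ ∀ t : ℝ, 0 ≤ t →
      ∃ t' : ℝ, 0 < t' ∧ q + t * D q = f (r * exp (θ * I)) + t' * exp (s θ * I) := by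
    intro q hq
    obtain ⟨θ, t₀, ht₀, h, hd⟩ := hD q hq
    refine ⟨θ, hd, fun t ht => ⟨t₀ + t, by linarith, ?_⟩⟩
    rw [hd, h]; push_cast; ring
  refine ⟨D, fun q hq => ?_, fun q hq q' hq' t t' ht ht' heq => ?_⟩
  · obtain ⟨θ, hd, h⟩ := hray q hq
    refine ⟨by rw [hd, norm_exp_ofReal_mul_I], fun t ht => ?_⟩
    obtain ⟨t', ht', h'⟩ := h t ht
    exact hf.ray_notMem hr hr1 hs ht' h'
  · obtain ⟨θ, hd, h⟩ := hray q hq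
    obtain ⟨θ', hd', h'⟩ := hray q' hq'
    obtain ⟨τ, hτ, e⟩ := h t ht
    obtain ⟨τ', hτ', e'⟩ := h' t' ht'
    have hn := hf.ray_notMem hr hr1 hs hτ e
    obtain ⟨Z, β, hZ, hβ⟩ := hf.exists_isArgLift hr hr1 (q := q + t * D q)
        (fun h => hn (image_mono sphere_subset_closedBall h))
    rw [hd, hd']
    rw [heq] at hβ e
    exact hs.ray_unique hβ hτ e hτ' e'

theorem isOpen_image (hf : HasOutwardCircles f) {U : Set ℂ} (hU : IsOpen U)
    (hU1 : U ⊆ ball 0 1) : IsOpen (f '' U) := by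
  rw [isOpen_iff_mem_nhds]
  rintro _ ⟨z, hz, rfl⟩
  rw [← hf.map_nhds z (hU1 hz)]
  exact Filter.image_mem_map (hU.mem_nhds hz)

/-! ### The limit `r → 1` -/

/-- The complement of the image of the disk carries a field of rays without transversal
crossings. -/
theorem exists_limit_directions (hf : HasOutwardCircles f) :
    ∃ d : ℂ → ℂ, (∀ w ∉ f '' ball 0 1, ‖d w‖ = 1 ∧
        ∀ t : ℝ, 0 ≤ t → w + t * d w ∉ f '' ball 0 1) ∧
      ∀ w ∉ f '' ball 0 1, ∀ w' ∉ f '' ball 0 1, ∀ t t' : ℝ, 0 < t → 0 < t' →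
        w + t * d w = w' + t' * d w' → (conj (d w) * d w').im = 0 := by
  have hex : ∀ r : ℝ, ∃ D : ℂ → ℂ, 0 < r → r < 1 → (∀ q ∉ f '' closedBall 0 r, ‖D q‖ = 1 ∧
        ∀ t : ℝ, 0 ≤ t → q + t * D q ∉ f '' closedBall 0 r) ∧
      ∀ q ∉ f '' closedBall 0 r, ∀ q' ∉ f '' closedBall 0 r, ∀ t t' : ℝ, 0 ≤ t → 0 ≤ t' →
        q + t * D q = q' + t' * D q' → D q = D q' := by
    intro r
    by_cases h : 0 < r ∧ r < 1
    · obtain ⟨D, hD⟩ := hf.exists_directions h.1 h.2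
      exact ⟨D, fun _ _ => hD⟩
    · exact ⟨0, fun h1 h2 => absurd ⟨h1, h2⟩ h⟩
  choose D hD using hex
  -- A single ultrafilter makes the directions converge at all points `w` simultaneously.
  set U : Ultrafilter ℝ := Ultrafilter.of (𝓝[<] (1 : ℝ)) with hU
  have hUle : (U : Filter ℝ) ≤ 𝓝[<] (1 : ℝ) := Ultrafilter.of_le _
  have hUr : ∀ a < (1 : ℝ), ∀ᶠ r in (U : Filter ℝ), a < r ∧ r < 1 := fun a ha =>
    hUle (Ioo_mem_nhdsLT ha)
  have hout : ∀ w ∉ f '' ball 0 1, ∀ r < (1 : ℝ), w ∉ f '' closedBall 0 r := fun w hw r hr h =>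
    hw (image_mono (closedBall_subset_ball hr) h)
  have hlim : ∀ w, ∃ d, w ∉ f '' ball 0 1 → ‖d‖ = 1 ∧ Filter.Tendsto (fun r => D r w) U (𝓝 d) := by
    intro w
    by_cases hw : w ∈ f '' ball 0 1
    · exact ⟨0, fun h => absurd hw h⟩
    · obtain ⟨d, hd, hle⟩ := (isCompact_sphere (0 : ℂ) 1).ultrafilter_le_nhds
        (U.map fun r => D r w) (by
          rw [Filter.le_principal_iff]
          change ∀ᶠ r in (U : Filter ℝ), D r w ∈ sphere (0 : ℂ) 1
          filter_upwards [hUr 0 one_pos] with r hr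
          simpa using (((hD r hr.1 hr.2).1 w (hout w hw r hr.2)).1))
      exact ⟨d, fun _ => ⟨by simpa using hd, hle⟩⟩
  choose d hd using hlim
  refine ⟨d, fun w hw => ⟨(hd w hw).1, fun t ht => ?_⟩, fun w hw w' hw' t t' ht ht' heq => ?_⟩
  · rintro ⟨z, hz, hfz⟩
    rw [mem_ball_zero_iff] at hz
    obtain ⟨R, hzR, hR1⟩ := exists_between hz
    have hop := hf.isOpen_image isOpen_ball (ball_subset_ball (x := (0 : ℂ)) hR1.le)
    have hmem : w + t * d w ∈ f '' ball 0 R := ⟨z, by simpa using hzR, hfz⟩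
    have hten : Filter.Tendsto (fun r => w + t * D r w) U (𝓝 (w + t * d w)) :=
      ((hd w hw).2.const_mul _).const_add _
    obtain ⟨r, h1, h2, h3⟩ := ((hten.eventually (hop.mem_nhds hmem)).and
      (hUr R hR1)).exists
    have hr0 : 0 < r := (norm_nonneg z).trans_lt (hzR.trans h2)
    exact ((hD r hr0 h3).1 w (hout w hw r h3)).2 t ht
      (image_mono ((ball_subset_ball h2.le).trans ball_subset_closedBall) h1)
  · by_contra hdet
    have l1 := (hd w hw).2
    have l2 := (hd w' hw').2
    have lconj : ∀ {g : ℝ → ℂ} {a : ℂ}, Filter.Tendsto g U (𝓝 a) →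
        Filter.Tendsto (fun r => conj (g r)) U (𝓝 (conj a)) := fun h =>
      (continuous_conj.tendsto _).comp h
    have limz : ∀ {g : ℝ → ℂ} {a : ℂ}, Filter.Tendsto g U (𝓝 a) →
        Filter.Tendsto (fun r => (g r).im) U (𝓝 a.im) := fun h =>
      (continuous_im.tendsto _).comp h
    -- A transversal crossing is stable: by Cramer's rule its parameters are quotients that
    -- converge, so for suitable `r < 1` the rays already cross at positive parameters with
    -- different directions.
    have lden := limz ((lconj l1).mul l2)
    have lnum := limz ((lconj (tendsto_const_nhds (x := w' - w))).mul l2)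
    have lnum' := limz ((lconj l1).mul (tendsto_const_nhds (x := w - w')))
    have cramer : ∀ a b x : ℂ, ∀ (t t' : ℝ), x = t * a - t' * b →
        (conj x * b).im = t * (conj a * b).im ∧ (conj a * -x).im = t' * (conj a * b).im := by
      rintro a b x t t' rfl
      constructor <;> simp <;> ring
    have solve : ∀ a b x : ℂ, (conj a * b).im ≠ 0 →
        x = ((conj x * b).im / (conj a * b).im : ℝ) * a
          - ((conj a * -x).im / (conj a * b).im : ℝ) * b := by
      intro a b x hne
      rw [ofReal_div, ofReal_div, div_mul_eq_mul_div, div_mul_eq_mul_div, ← sub_div,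
        eq_div_iff (by exact_mod_cast hne)]
      apply Complex.ext <;> simp <;> ring
    obtain ⟨c1, c2⟩ := cramer (d w) (d w') (w' - w) t t' (by linear_combination -heq)
    rw [neg_sub] at c2
    have q1 := lnum.div lden hdet
    have q2 := lnum'.div lden hdet
    rw [c1, mul_div_cancel_right₀ _ hdet] at q1
    rw [c2, mul_div_cancel_right₀ _ hdet] at q2
    obtain ⟨r, ⟨h1, h2, h3⟩, h4, h5⟩ := ((q1.eventually (lt_mem_nhds ht)).and
      ((q2.eventually (lt_mem_nhds ht')).and (lden.eventually (isOpen_ne.mem_nhds hdet)))).and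
      (hUr 0 one_pos) |>.exists
    have hsame := (hD r h4 h5).2 w (hout w hw r h5) w' (hout w' hw' r h5) _ _ h1.le h2.le (by
      have := solve (D r w) (D r w') (w' - w) h3
      rw [neg_sub] at this
      rw [Pi.div_apply, Pi.div_apply]
      linear_combination -this)
    apply h3
    rw [hsame]
    simp; ring

end HasOutwardCircles

/-! ### Merging rays into half-lines with disjoint interiors -/

namespace RayField

variable (Ω : Set ℂ) (d : ℂ → ℂ)

/-- Positions, on the line with direction `u` and signed distance `y` from `0`, of the points
outside `Ω` whose ray has direction `u`. -/
def origins (u : ℂ) (y : ℝ) : Set ℝ := {x | (x + y * I) * u ∉ Ω ∧ d ((x + y * I) * u) = u}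

/-- The point with position `x` lies in the interior of a ray contained in the line. -/
def Covered (u : ℂ) (y x : ℝ) : Prop :=
  (∃ a ∈ origins Ω d u y, a < x) ∨ ∃ a ∈ origins Ω d (-u) (-y), a < -x

/-- The whole line consists of interiors of rays contained in it. -/
def Full (u : ℂ) (y : ℝ) : Prop := ∀ x, Covered Ω d u y x

/-- `α` is the position of the origin of the maximal half-line of direction `u` on the line; a line
consisting of rays is cut into two half-lines at position `0`. -/
def IsOrigin (u : ℂ) (y α : ℝ) : Prop :=
  (Full Ω d u y ∧ α = 0) ∨
    (¬ Full Ω d u y ∧ (origins Ω d u y).Nonempty ∧ α = sInf (origins Ω d u y))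

variable {Ω d}

theorem Covered.neg {u : ℂ} {y x : ℝ} (h : Covered Ω d u y x) : Covered Ω d (-u) (-y) (-x) := by
  rcases h with h | h
  · exact Or.inr (by simpa using h)
  · exact Or.inl h

theorem Full.neg {u : ℂ} {y : ℝ} (h : Full Ω d u y) : Full Ω d (-u) (-y) := fun x => by
  simpa using (h (-x)).neg

theorem Covered.exists_ray {u : ℂ} {y x : ℝ} (h : Covered Ω d u y x) :
    ∃ w ∉ Ω, ∃ t : ℝ, 0 < t ∧ (x + y * I) * u = w + t * d w ∧ (d w = u ∨ d w = -u) := by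
  rcases h with ⟨a, ⟨h1, h2⟩, hax⟩ | ⟨a, ⟨h1, h2⟩, hax⟩
  · exact ⟨_, h1, x - a, by linarith, by rw [h2]; push_cast; ring, Or.inl h2⟩
  · exact ⟨_, h1, -x - a, by linarith, by rw [h2]; push_cast; ring, Or.inr h2⟩

theorem IsOrigin.covered {u : ℂ} {y α x : ℝ} (h : IsOrigin Ω d u y α) (hx : α < x) :
    Covered Ω d u y x := by
  rcases h with ⟨h, -⟩ | ⟨-, h, rfl⟩
  · exact h x
  · exact Or.inl (exists_lt_of_csInf_lt h hx)

theorem IsOrigin.unique {u : ℂ} {y α α' : ℝ} (h : IsOrigin Ω d u y α) (h' : IsOrigin Ω d u y α') :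
    α = α' := by
  rcases h with ⟨h, rfl⟩ | ⟨h, -, rfl⟩ <;> rcases h' with ⟨h', rfl⟩ | ⟨h', -, rfl⟩
  · rfl
  · exact absurd h h'
  · exact absurd h' h
  · rfl

/-- Two opposing rays that overlap cover the whole line, and a full line is cut at the same point
`0` from both sides. -/
theorem IsOrigin.not_lt {u : ℂ} {y α α' x : ℝ} (h : IsOrigin Ω d u y α)
    (h' : IsOrigin Ω d (-u) (-y) α') (hx : α < x) : ¬ α' < -x := by
  intro hx'
  have hfull : Full Ω d (-u) (-y) ↔ Full Ω d u y :=
    ⟨fun h => by simpa using h.neg, fun h => h.neg⟩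
  rcases h with ⟨h, rfl⟩ | ⟨h, hne, rfl⟩ <;> rcases h' with ⟨h', rfl⟩ | ⟨h', hne', rfl⟩
  · linarith
  · exact h' (hfull.2 h)
  · exact h (hfull.1 h')
  · obtain ⟨a, ha, hax⟩ := exists_lt_of_csInf_lt hne hx
    obtain ⟨b, hb, hbx⟩ := exists_lt_of_csInf_lt hne' hx'
    refine h fun x₀ => ?_
    rcases lt_or_ge a x₀ with h0 | h0
    · exact Or.inl ⟨a, ha, h0⟩
    · exact Or.inr ⟨b, hb, by linarith⟩

theorem conj_mul_coord {u : ℂ} (hu : ‖u‖ = 1) (x y : ℝ) :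
    conj u * ((x + y * I) * u) = x + y * I := by
  have : conj u * u = 1 := by rw [Complex.conj_mul', hu]; simp
  linear_combination (x + y * I) * this

theorem coord_injective {u : ℂ} (hu : ‖u‖ = 1) {x y x' y' : ℝ}
    (h : (x + y * I) * u = (x' + y' * I) * u) : x = x' ∧ y = y' := by
  have h1 := conj_mul_coord hu x y
  rw [h, conj_mul_coord hu] at h1
  have h2 := congrArg re h1
  have h3 := congrArg im h1
  simp at h2 h3
  exact ⟨h2.symm, h3.symm⟩

theorem exists_coord {u : ℂ} (hu : ‖u‖ = 1) (w : ℂ) : ∃ x y : ℝ, w = (x + y * I) * u := by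
  refine ⟨(conj u * w).re, (conj u * w).im, ?_⟩
  rw [re_add_im]
  have : conj u * u = 1 := by rw [Complex.conj_mul', hu]; simp
  linear_combination -w * this

theorem eq_or_eq_neg_of_im_eq_zero {u v : ℂ} (hu : ‖u‖ = 1) (hv : ‖v‖ = 1)
    (h : (conj u * v).im = 0) : v = u ∨ v = -u := by
  obtain ⟨x, y, rfl⟩ := exists_coord hu v
  rw [conj_mul_coord hu] at h
  simp only [add_im, ofReal_im, mul_im, ofReal_re, I_im, mul_one, I_re, mul_zero, add_zero,
    zero_add] at h
  rw [norm_mul, hu, mul_one, h, ofReal_zero, zero_mul, add_zero, norm_real, Real.norm_eq_abs] at hv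
  rcases (abs_eq one_pos.le).1 hv with hx | hx <;> simp [h, hx]

end RayField

open RayField in
/-- An open set is close-to-convex if its complement carries a field of rays without transversal
crossings. -/
theorem IsCloseToConvexSet.of_rayField {Ω : Set ℂ} (hΩ : IsOpen Ω) {d : ℂ → ℂ}
    (hd : ∀ w ∉ Ω, ‖d w‖ = 1 ∧ ∀ t : ℝ, 0 ≤ t → w + t * d w ∉ Ω)
    (hcross : ∀ w ∉ Ω, ∀ w' ∉ Ω, ∀ t t' : ℝ, 0 < t → 0 < t' →
      w + t * d w = w' + t' * d w' → (conj (d w) * d w').im = 0) :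
    IsCloseToConvexSet Ω := by
  refine ⟨{p | ∃ (u : ℂ) (y α : ℝ), ‖u‖ = 1 ∧ IsOrigin Ω d u y α ∧ p = ((α + y * I) * u, u)},
    ?_, ?_, ?_⟩
  · rintro _ ⟨u, y, α, hu, -, rfl⟩
    exact hu
  · ext w
    simp only [mem_compl_iff, mem_iUnion, exists_prop]
    constructor
    · intro hw
      obtain ⟨hu, -⟩ := hd w hw
      obtain ⟨x, y, hxy⟩ := exists_coord hu w
      have hmem : x ∈ origins Ω d (d w) y := by
        refine ⟨?_, ?_⟩ <;> rw [← hxy]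
        exact hw
      by_cases hf : Full Ω d (d w) y
      · rcases le_total 0 x with hx | hx
        · refine ⟨_, ⟨d w, y, 0, hu, Or.inl ⟨hf, rfl⟩, rfl⟩, x, hx, ?_⟩
          push_cast
          linear_combination hxy
        · refine ⟨_, ⟨-d w, -y, 0, by rwa [norm_neg], Or.inl ⟨hf.neg, rfl⟩, rfl⟩, -x,
            by linarith, ?_⟩
          push_cast
          linear_combination hxy
      · have hbdd : BddBelow (origins Ω d (d w) y) := by
          by_contra hb
          rw [not_bddBelow_iff] at hb
          exact hf fun x => Or.inl (hb x)
        refine ⟨_, ⟨d w, y, _, hu, Or.inr ⟨hf, ⟨x, hmem⟩, rfl⟩, rfl⟩,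
          x - sInf (origins Ω d (d w) y), sub_nonneg.2 (csInf_le hbdd hmem), ?_⟩
        push_cast
        linear_combination hxy
    · rintro ⟨_, ⟨u, y, α, hu, hα, rfl⟩, t, ht, hw⟩ hwΩ
      -- The infimum defining `α` need not be attained, so the endpoint may lie on no ray. If it
      -- were in the open set `Ω`, so would be a slightly later point, which is covered.
      have hcont : Continuous fun ε : ℝ => w + ε * u := by fun_prop
      have hev : ∀ᶠ ε : ℝ in 𝓝[>] 0, w + ε * u ∈ Ω :=
        (hcont.continuousAt.eventually (hΩ.mem_nhds (by simpa using hwΩ))).filter_mono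
          nhdsWithin_le_nhds
      obtain ⟨ε, hεΩ, hε⟩ := (hev.and self_mem_nhdsWithin).exists
      have hε : 0 < ε := hε
      obtain ⟨v, hv, τ, hτ, he, -⟩ :=
        (hα.covered (show α < α + t + ε by linarith)).exists_ray
      refine (hd v hv).2 τ hτ.le ?_
      rw [← he]
      convert hεΩ using 1
      rw [hw]
      push_cast
      ring
  · rintro _ ⟨u, y, α, hu, hα, rfl⟩ _ ⟨u', y', α', hu', hα', rfl⟩ hne
    rw [Set.disjoint_left]
    rintro z ⟨t, ht, hz⟩ ⟨t', ht', hz'⟩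
    have hz : z = (((α + t : ℝ) : ℂ) + y * I) * u := by rw [hz]; push_cast; ring
    have hz' : z = (((α' + t' : ℝ) : ℂ) + y' * I) * u' := by rw [hz']; push_cast; ring
    have hx : α < α + t := by linarith
    have hx' : α' < α' + t' := by linarith
    obtain ⟨w, hw, τ, hτ, he, hdw⟩ := (hα.covered hx).exists_ray
    obtain ⟨w', hw', τ', hτ', he', hdw'⟩ := (hα'.covered hx').exists_ray
    have him := hcross w hw w' hw' τ τ' hτ hτ' (by rw [← he, ← he', ← hz, ← hz'])
    have him : (conj u * u').im = 0 := by
      rcases hdw with h | h <;> rcases hdw' with h' | h' <;> rw [h, h'] at him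
      · exact him
      · rwa [mul_neg, neg_im, neg_eq_zero] at him
      · rwa [map_neg, neg_mul, neg_im, neg_eq_zero] at him
      · rwa [map_neg, neg_mul_neg] at him
    rcases eq_or_eq_neg_of_im_eq_zero hu hu' him with rfl | rfl
    · obtain ⟨-, rfl⟩ := coord_injective hu (hz.symm.trans hz')
      exact hne (by rw [hα.unique hα'])
    · have hz'' : z = (((-(α' + t') : ℝ) : ℂ) + (-y' : ℝ) * I) * u := by
        rw [hz']; push_cast; ring
      obtain ⟨hxx, hyy⟩ := coord_injective hu (hz.symm.trans hz'')
      obtain rfl : y' = -y := by linarith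
      exact hα.not_lt hα' hx (by linarith)

/-- A map with outward directed circles is close-to-convex. -/
theorem HasOutwardCircles.isCloseToConvexOnDisk {f : ℂ → ℂ} (hf : HasOutwardCircles f) :
    IsCloseToConvexOnDisk f := by
  obtain ⟨d, hd, hcross⟩ := hf.exists_limit_directions
  exact ⟨hf.injOn, .of_rayField (hf.isOpen_image isOpen_ball Subset.rfl) hd hcross⟩

/-! ### Locally injective analytic functions -/

/-- An analytic function that is injective near a point has nonzero derivative there. -/
theorem AnalyticAt.deriv_ne_zero_of_injOn {h : ℂ → ℂ} {z : ℂ} (hh : AnalyticAt ℂ h z) {U : Set ℂ}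
    (hU : U ∈ 𝓝 z) (hinj : InjOn h U) : deriv h z ≠ 0 := by
  have hφ : AnalyticAt ℂ (fun w => h w - h z) z := hh.sub analyticAt_const
  have hne : ¬ ∀ᶠ w in 𝓝 z, h w - h z = 0 := by
    intro hev
    obtain ⟨w, ⟨hw1, hw2⟩, hw3⟩ :=
      (((hev.and hU).filter_mono nhdsWithin_le_nhds).and self_mem_nhdsWithin :
        ∀ᶠ w in 𝓝[≠] z, _).exists
    exact hw3 (hinj hw2 (mem_of_mem_nhds hU) (sub_eq_zero.1 hw1))
  obtain ⟨n, g, hg, hgz, hev⟩ := hφ.exists_eventuallyEq_pow_smul_nonzero_iff.2 hne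
  have hn0 : n ≠ 0 := by
    rintro rfl
    have := hev.self_of_nhds
    simp only [sub_self, pow_zero, one_smul] at this
    exact hgz this.symm
  have hn0' : (n : ℂ) ≠ 0 := by exact_mod_cast hn0
  rcases Nat.lt_or_ge n 2 with hn | hn
  · obtain rfl : n = 1 := by omega
    have h1 : HasDerivAt (fun w => (w - z) ^ 1 • g w) (g z) z := by
      have := ((hasDerivAt_id z).sub_const z).fun_mul hg.differentiableAt.hasDerivAt
      simpa using this
    have h2 : HasDerivAt (fun w => h w - h z) (g z) z := h1.congr_of_eventuallyEq hev
    have h3 : HasDerivAt h (g z) z := by simpa using h2.add_const (h z)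
    rwa [h3.deriv]
  · exfalso
    -- `c` is an `n`-th root of `g / g z`, so `h - h z = g z * k ^ n` in the local coordinate `k =
    -- (w - z) * c w`. The points with coordinates `v` and `ζ * v` then have equal values,
    -- contradicting injectivity.
    set c : ℂ → ℂ := fun w => Complex.exp (Complex.log (g w / g z) / n) with hc
    have hcz : c z = 1 := by simp [hc, div_self hgz]
    have hca : AnalyticAt ℂ c z := by
      have : AnalyticAt ℂ (fun w => Complex.log (g w / g z)) z :=
        (hg.div analyticAt_const hgz).clog (by simp [div_self hgz])
      exact (this.div analyticAt_const hn0').cexp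
    have hk : HasStrictDerivAt (fun w => (w - z) * c w) 1 z := by
      have := HasStrictDerivAt.fun_mul ((hasStrictDerivAt_id z).sub_const z) hca.hasStrictDerivAt
      simpa [hcz] using this
    have hmap := hk.map_nhds_eq one_ne_zero
    simp only [sub_self, zero_mul] at hmap
    have hV : ∀ᶠ w in 𝓝 z, w ∈ U ∧ h w - h z = (w - z) ^ n • g w ∧ g w ≠ 0 :=
      Filter.Eventually.and hU (hev.and (hg.continuousAt.eventually (isOpen_ne.mem_nhds hgz)))
    have himg := Filter.image_mem_map (m := fun w => (w - z) * c w) hV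
    rw [hmap] at himg
    set ζ : ℂ := Complex.exp (2 * π * I / n) with hζ
    have hprim : IsPrimitiveRoot ζ n := Complex.isPrimitiveRoot_exp n hn0
    have himg' : ∀ᶠ v in 𝓝 (0 : ℂ), ζ * v ∈
        (fun w => (w - z) * c w) '' {w | w ∈ U ∧ h w - h z = (w - z) ^ n • g w ∧ g w ≠ 0} := by
      have : Filter.Tendsto (fun v : ℂ => ζ * v) (𝓝 0) (𝓝 0) := by
        simpa only [mul_zero] using (continuous_const_mul ζ).tendsto 0
      exact this.eventually himg
    obtain ⟨v, ⟨⟨w₁, ⟨hw₁, e₁, g₁⟩, k₁⟩, w₂, ⟨hw₂, e₂, g₂⟩, k₂⟩, hv⟩ :=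
      ((((Filter.Eventually.and himg himg').filter_mono nhdsWithin_le_nhds)).and
        self_mem_nhdsWithin : ∀ᶠ v in 𝓝[≠] (0 : ℂ), _).exists
    have hpow : ∀ w, g w ≠ 0 → h w - h z = (w - z) ^ n • g w →
        h w - h z = ((w - z) * c w) ^ n * g z := by
      intro w hw e
      have : c w ^ n = g w / g z := by
        simp only [hc]
        rw [← exp_nat_mul, mul_div_cancel₀ _ hn0', exp_log (div_ne_zero hw hgz)]
      rw [mul_pow, this, e, smul_eq_mul, mul_assoc, div_mul_cancel₀ _ hgz]
    have heq : h w₁ = h w₂ := by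
      have q₁ := hpow w₁ g₁ e₁
      have q₂ := hpow w₂ g₂ e₂
      simp only at k₁ k₂
      rw [k₁] at q₁
      rw [k₂, mul_pow, hprim.pow_eq_one, one_mul, ← q₁] at q₂
      exact (sub_left_inj.1 q₂).symm
    obtain rfl := hinj hw₁ hw₂ heq
    simp only at k₁ k₂
    rw [k₁] at k₂
    have : ζ = 1 := by
      have h0 : (ζ - 1) * v = 0 := by linear_combination -k₂
      exact sub_eq_zero.1 ((mul_eq_zero.1 h0).resolve_right hv)
    exact hprim.ne_one (by omega) this

/-! ### Local behaviour of sense-preserving harmonic maps -/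

section Harmonic

variable {h g : ℂ → ℂ} {a A B : ℂ}

theorem hasStrictFDerivAt_add_conj (hh : HasStrictDerivAt h A a) (hg : HasStrictDerivAt g B a) :
    ∃ L : ℂ →L[ℝ] ℂ, (∀ v, L v = A * v + conj (B * v)) ∧
      HasStrictFDerivAt (fun z => h z + conj (g z)) L a := by
  have h1 := hh.hasStrictFDerivAt.restrictScalars ℝ
  have h2 := hg.hasStrictFDerivAt.restrictScalars ℝ
  have h3 := (conjCLE.toContinuousLinearMap.hasStrictFDerivAt (x := g a)).comp a h2
  refine ⟨_, fun v => ?_, h1.add h3⟩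
  simp [mul_comm]

/-- The analytic part dominates the conjugate part; any `k` between `‖B‖ / ‖A‖` and `1` leaves room
for the remainder. -/
theorem isPositiveZero_add_conj (hh : HasStrictDerivAt h A a) (hg : HasStrictDerivAt g B a)
    (hBA : ‖B‖ < ‖A‖) :
    IsPositiveZero (fun z => h z + conj (g z) - (h a + conj (g a))) a := by
  obtain ⟨L, hL, hd⟩ := hasStrictFDerivAt_add_conj hh hg
  have hA : 0 < ‖A‖ := (norm_nonneg _).trans_lt hBA
  obtain ⟨k, hk, hk1⟩ := exists_between ((div_lt_one hA).2 hBA)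
  rw [div_lt_iff₀ hA] at hk
  refine ⟨A, norm_pos_iff.1 hA, k, hk1, ?_⟩
  filter_upwards [hd.hasFDerivAt.isLittleO.bound (sub_pos.2 hk)] with z hz
  rw [hL] at hz
  have e : h z + conj (g z) - (h a + conj (g a)) - A * (z - a)
      = (h z + conj (g z) - (h a + conj (g a)) - (A * (z - a) + conj (B * (z - a))))
        + conj (B * (z - a)) := by ring
  rw [e]
  refine (norm_add_le _ _).trans ?_
  rw [RCLike.norm_conj, norm_mul]
  linarith

theorem map_nhds_add_conj (hh : HasStrictDerivAt h A a) (hg : HasStrictDerivAt g B a)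
    (hBA : ‖B‖ < ‖A‖) :
    Filter.map (fun z => h z + conj (g z)) (𝓝 a) = 𝓝 (h a + conj (g a)) := by
  obtain ⟨L, hL, hd⟩ := hasStrictFDerivAt_add_conj hh hg
  refine hd.map_nhds_eq_of_surj ?_
  have hinj : Function.Injective (L : ℂ →ₗ[ℝ] ℂ) := by
    rw [← LinearMap.ker_eq_bot, LinearMap.ker_eq_bot']
    intro v hv
    have hv : A * v + conj (B * v) = 0 := by rw [← hL]; exact hv
    by_contra hv0
    have h1 := congrArg norm (eq_neg_of_add_eq_zero_left hv)
    rw [norm_neg, RCLike.norm_conj, norm_mul, norm_mul] at h1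
    exact hBA.ne' (mul_right_cancel₀ (norm_ne_zero_iff.2 hv0) h1)
  exact LinearMap.range_eq_top.2 (LinearMap.injective_iff_surjective.1 hinj)

end Harmonic

/-! ### Boundary rotation and monotone angles -/

theorem add_nat_mul_period {H : ℝ → ℝ} (hper : ∀ θ, H (θ + 2 * π) = H θ + 2 * π) (θ : ℝ) (k : ℕ) :
    H (θ + k * (2 * π)) = H θ + k * (2 * π) := by
  induction k with
  | zero => simp
  | succ k ih =>
    rw [show θ + ((k + 1 : ℕ) : ℝ) * (2 * π) = θ + k * (2 * π) + 2 * π by push_cast; ring, hper, ih]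
    push_cast; ring

theorem exists_eq_sub_add_nat_mul {θ t : ℝ} (h : t ≤ θ) :
    ∃ x ∈ Icc 0 (2 * π), ∃ k : ℕ, θ - x = t + k * (2 * π) := by
  have hπ := Real.two_pi_pos
  have h0 : 0 ≤ (θ - t) / (2 * π) := div_nonneg (sub_nonneg.2 h) hπ.le
  have h1 := Nat.floor_le h0
  have h2 := Nat.lt_floor_add_one ((θ - t) / (2 * π))
  rw [le_div_iff₀ hπ] at h1
  rw [div_lt_iff₀ hπ] at h2
  exact ⟨θ - t - ⌊(θ - t) / (2 * π)⌋₊ * (2 * π), ⟨by linarith, by linarith⟩,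
    ⌊(θ - t) / (2 * π)⌋₊, by ring⟩

/-- An angle function that never decreases by more than `2 * c` is within `c` of a nondecreasing
one. -/
theorem exists_monotone_angle {H : ℝ → ℝ} (hH : Continuous H)
    (hper : ∀ θ, H (θ + 2 * π) = H θ + 2 * π) {c : ℝ}
    (hdec : ∀ θ₁ θ₂, θ₁ ≤ θ₂ → H θ₁ - 2 * c ≤ H θ₂) :
    ∃ s : ℝ → ℝ, Continuous s ∧ Monotone s ∧ (∀ θ, s (θ + 2 * π) = s θ + 2 * π) ∧
      ∀ θ, |H θ - s θ| ≤ c := by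
  have hπ := Real.two_pi_pos
  -- The running supremum over the whole past: as `H` gains `2π` per turn, the last period suffices,
  -- and this compact window gives continuity. Then `H ≤ S ≤ H + 2c`, and subtracting `c` centres
  -- the error.
  set S : ℝ → ℝ := fun θ => sSup ((fun x => H (θ - x)) '' Icc 0 (2 * π)) with hS
  have hbdd : ∀ θ, BddAbove ((fun x => H (θ - x)) '' Icc 0 (2 * π)) := fun θ =>
    isCompact_Icc.bddAbove_image (by fun_prop)
  have hle : ∀ t θ, t ≤ θ → H t ≤ S θ := by
    intro t θ h
    obtain ⟨x, hx, k, hk⟩ := exists_eq_sub_add_nat_mul h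
    have h1 : H (θ - x) ≤ S θ := le_csSup (hbdd θ) (mem_image_of_mem _ hx)
    rw [hk, add_nat_mul_period hper] at h1
    have : (0 : ℝ) ≤ k * (2 * π) := by positivity
    linarith
  have hge : ∀ θ b, (∀ t ≤ θ, H t ≤ b) → S θ ≤ b := by
    intro θ b hb
    refine csSup_le ((nonempty_Icc.2 hπ.le).image _) ?_
    rintro _ ⟨x, hx, rfl⟩
    exact hb _ (by linarith [hx.1])
  refine ⟨fun θ => S θ - c, ?_, ?_, ?_, ?_⟩
  · have : Continuous S := isCompact_Icc.continuous_sSup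
      (f := fun θ x => H (θ - x)) (by
        change Continuous fun q : ℝ × ℝ => H (q.1 - q.2)
        fun_prop)
    exact this.sub continuous_const
  · intro θ₁ θ₂ h
    exact sub_le_sub_right (hge _ _ fun t ht => hle t θ₂ (ht.trans h)) c
  · intro θ
    have h1 : S (θ + 2 * π) ≤ S θ + 2 * π := hge _ _ fun t ht => by
      have := hle (t - 2 * π) θ (by linarith)
      have h2 := hper (t - 2 * π)
      rw [sub_add_cancel] at h2
      linarith
    have h2 : S θ ≤ S (θ + 2 * π) - 2 * π := hge _ _ fun t ht => by
      have := hle (t + 2 * π) (θ + 2 * π) (by linarith)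
      rw [hper] at this
      linarith
    simp only
    linarith
  · intro θ
    have h1 := hle θ θ le_rfl
    have h2 : S θ ≤ H θ + 2 * c := hge _ _ fun t ht => by linarith [hdec t θ ht]
    rw [abs_le]
    constructor <;> linarith

/-- A bound for the total variation over a period bounds the decrease of an angle function. -/
theorem sub_le_of_integral_abs_le {H D : ℝ → ℝ} (hHD : ∀ θ, HasDerivAt H (D θ) θ)
    (hD : Continuous D) (hper : ∀ θ, H (θ + 2 * π) = H θ + 2 * π) {K : ℝ}
    (hK : ∫ θ in (0 : ℝ)..(2 * π), |D θ| ≤ K * π) {θ₁ θ₂ : ℝ} (h : θ₁ ≤ θ₂) :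
    H θ₁ - 2 * ((K - 2) * π / 4) ≤ H θ₂ := by
  have hDper : Function.Periodic (fun θ => |D θ|) (2 * π) := by
    intro θ
    have h1 : HasDerivAt (fun x => H (x + 2 * π)) (D (θ + 2 * π)) θ :=
      (hHD (θ + 2 * π)).comp_add_const θ (2 * π)
    have h2 : HasDerivAt (fun x => H (x + 2 * π)) (D θ) θ := by
      simp only [hper]
      exact (hHD θ).add_const _
    simp only [h1.unique h2]
  have hint : ∀ a b, IntervalIntegrable D MeasureTheory.volume a b := fun a b =>
    hD.intervalIntegrable a b
  have hftc : ∀ a b, ∫ θ in a..b, D θ = H b - H a := fun a b =>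
    intervalIntegral.integral_eq_sub_of_hasDerivAt (fun θ _ => hHD θ) (hint a b)
  -- A drop of size `x` within a turn must be made up by a rise of `2π + x`, so `2π + 2x ≤ Kπ`.
  have hshort : ∀ t, θ₁ ≤ t → t ≤ θ₁ + 2 * π → H θ₁ - 2 * ((K - 2) * π / 4) ≤ H t := by
    intro t h1 h2
    have e1 : ∫ θ in θ₁..(θ₁ + 2 * π), |D θ| ≤ K * π := by
      rw [hDper.intervalIntegral_add_eq θ₁ 0, zero_add]
      exact hK
    rw [← intervalIntegral.integral_add_adjacent_intervals (b := t)
      (hD.abs.intervalIntegrable _ _) (hD.abs.intervalIntegrable _ _)] at e1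
    have e2 := intervalIntegral.abs_integral_le_integral_abs (μ := MeasureTheory.volume)
      (f := D) h1
    have e3 := intervalIntegral.abs_integral_le_integral_abs (μ := MeasureTheory.volume)
      (f := D) h2
    rw [hftc] at e2 e3
    have e4 := neg_abs_le (H t - H θ₁)
    have e5 := le_abs_self (H (θ₁ + 2 * π) - H t)
    have e6 := hper θ₁
    linarith
  obtain ⟨x, hx, k, hk⟩ := exists_eq_sub_add_nat_mul h
  have h1 := hshort (θ₁ + x) (by linarith [hx.1]) (by linarith [hx.2])
  have h2 := add_nat_mul_period hper (θ₁ + x) k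
  rw [show θ₁ + x + k * (2 * π) = θ₂ by linarith] at h2
  have : (0 : ℝ) ≤ k * (2 * π) := by positivity
  linarith

/-- A nonvanishing analytic derivative on the disk has an analytic logarithm. -/
theorem exists_log_deriv {h : ℂ → ℂ} (hh : AnalyticOnNhd ℂ h (ball 0 1))
    (hne : ∀ z ∈ ball (0 : ℂ) 1, deriv h z ≠ 0) :
    ∃ L : ℂ → ℂ, (∀ z ∈ ball (0 : ℂ) 1, HasDerivAt L (deriv (deriv h) z / deriv h z) z) ∧
      ∀ z ∈ ball (0 : ℂ) 1, exp (L z) = deriv h z := by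
  have h1 := hh.deriv
  have h2 := h1.deriv
  have hdiff : DifferentiableOn ℂ (fun z => deriv (deriv h) z / deriv h z) (ball 0 1) :=
    h2.differentiableOn.div h1.differentiableOn hne
  have h0 : (0 : ℂ) ∈ ball (0 : ℂ) 1 := mem_ball_self one_pos
  obtain ⟨L, hL0, hL⟩ := hdiff.isExactOn_ball.with_val_at 0 (log (deriv h 0))
  refine ⟨L, hL, fun z hz => ?_⟩
  have hd : ∀ w ∈ ball (0 : ℂ) 1, HasDerivAt (fun w => deriv h w * exp (-L w)) 0 w := by
    intro w hw
    have := (h1 w hw).differentiableAt.hasDerivAt.fun_mul (hL w hw).fun_neg.cexp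
    refine this.congr_deriv ?_
    have := hne w hw
    field_simp
    ring
  have := isOpen_ball.is_const_of_deriv_eq_zero (convex_ball (0 : ℂ) 1).isPreconnected
    (fun w hw => (hd w hw).differentiableAt.differentiableWithinAt)
    (fun w hw => (hd w hw).deriv) hz h0
  simp only [hL0] at this
  rw [Complex.exp_neg, Complex.exp_neg, exp_log (hne 0 h0), mul_inv_cancel₀ (hne 0 h0)] at this
  exact ((mul_inv_eq_one₀ (exp_ne_zero _)).1 this).symm

theorem BoundaryRotationClass.deriv_ne_zero {K : ℝ} {h : ℂ → ℂ} (hh : BoundaryRotationClass K h)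
    {z : ℂ} (hz : z ∈ ball (0 : ℂ) 1) : deriv h z ≠ 0 := by
  obtain ⟨U, hU, hinj⟩ := hh.locallyUnivalent z hz
  exact (hh.analytic z hz).deriv_ne_zero_of_injOn hU hinj

/-- The argument of `z * h' z` on a circle is within `(K - 2) * π / 4` of a nondecreasing
function. -/
theorem BoundaryRotationClass.exists_angle {K : ℝ} {h : ℂ → ℂ} (hh : BoundaryRotationClass K h)
    {r : ℝ} (hr : 0 < r) (hr1 : r < 1) :
    ∃ H s : ℝ → ℝ, Continuous s ∧ Monotone s ∧ (∀ θ, s (θ + 2 * π) = s θ + 2 * π) ∧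
      (∀ θ, |H θ - s θ| ≤ (K - 2) * π / 4) ∧
      ∀ θ : ℝ, r * exp (θ * I) * deriv h (r * exp (θ * I))
        = (r * ‖deriv h (r * exp (θ * I))‖ : ℝ) * exp (H θ * I) := by
  obtain ⟨L, hL, hexp⟩ := exists_log_deriv hh.analytic fun z hz => hh.deriv_ne_zero hz
  have hz : ∀ θ : ℝ, (r * exp (θ * I) : ℂ) ∈ ball (0 : ℂ) 1 := fun θ => by
    rwa [mem_ball_zero_iff, norm_mul, norm_exp_ofReal_mul_I, norm_real, Real.norm_of_nonneg hr.le,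
      mul_one]
  have hzd : ∀ θ : ℝ, HasDerivAt (fun θ : ℝ => (r * exp (θ * I) : ℂ)) (r * exp (θ * I) * I) θ := by
    intro θ
    have h1 : HasDerivAt (fun θ : ℝ => (θ * I : ℂ)) I θ := by
      simpa using (ofRealCLM.hasDerivAt (x := θ)).mul_const I
    simpa [mul_assoc] using h1.cexp.const_mul (r : ℂ)
  -- The argument of `z h'(z)`, with `L` a logarithm of `h'`; its derivative is the integrand of the
  -- boundary rotation.
  set H : ℝ → ℝ := fun θ => θ + (L (r * exp (θ * I))).im with hHdef
  have hHD : ∀ θ : ℝ, HasDerivAt H (1 + (r * exp (θ * I)) * deriv (deriv h) (r * exp (θ * I)) /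
          deriv h (r * exp (θ * I))).re θ := by
    intro θ
    have h1 := (hL _ (hz θ)).comp_of_eq θ (hzd θ) rfl
    have h2 := imCLM.hasFDerivAt.comp_hasDerivAt θ h1
    refine ((hasDerivAt_id θ).fun_add h2).congr_deriv ?_
    rw [add_re, one_re]
    congr 1
    rw [show deriv (deriv h) (r * exp (θ * I)) / deriv h (r * exp (θ * I)) * (r * exp (θ * I) * I)
      = (r * exp (θ * I)) * deriv (deriv h) (r * exp (θ * I)) / deriv h (r * exp (θ * I)) * I by
        ring]
    simp
  have hper : ∀ θ, H (θ + 2 * π) = H θ + 2 * π := by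
    intro θ
    have : exp (((θ + 2 * π : ℝ) : ℂ) * I) = exp (θ * I) := by
      rw [Complex.exp_eq_exp_iff_exists_int]
      exact ⟨1, by push_cast; ring⟩
    simp only [hHdef, this]
    ring
  have hzc : Continuous fun θ : ℝ => (r * exp (θ * I) : ℂ) := by fun_prop
  have hcomp : ∀ {F : ℂ → ℂ}, AnalyticOnNhd ℂ F (ball 0 1) →
      Continuous fun θ : ℝ => F (r * exp (θ * I)) := fun hF =>
    hF.continuousOn.comp_continuous hzc hz
  have hDc : Continuous fun θ : ℝ => (1 + (r * exp (θ * I)) * deriv (deriv h) (r * exp (θ * I)) /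
          deriv h (r * exp (θ * I))).re := by
    refine continuous_re.comp (continuous_const.add ?_)
    exact (hzc.mul (hcomp hh.analytic.deriv.deriv)).div (hcomp hh.analytic.deriv)
      fun θ => hh.deriv_ne_zero (hz θ)
  have hHc : Continuous H := continuous_iff_continuousAt.2 fun θ => (hHD θ).continuousAt
  obtain ⟨s, h1, h2, h3, h4⟩ := exists_monotone_angle hHc hper (c := (K - 2) * π / 4)
    fun θ₁ θ₂ h => sub_le_of_integral_abs_le hHD hDc hper (hh.rotation_le r hr hr1) h
  refine ⟨H, s, h1, h2, h3, h4, fun θ => ?_⟩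
  rw [← hexp _ (hz θ), norm_exp]
  conv_lhs => rw [← re_add_im (L (r * exp (θ * I)))]
  rw [Complex.exp_add]
  simp only [hHdef]
  push_cast
  rw [add_mul, Complex.exp_add]
  ring

/-! ### The harmonic mapping -/

/-- The harmonic mapping `h + conj g` has outward directed circles. -/
theorem hasOutwardCircles_add_conj {K δ : ℝ} {h g ω : ℂ → ℂ}
    (hδ0 : 0 ≤ δ) (hK : K ≤ 4 - δ)
    (hh : BoundaryRotationClass K h)
    (hg : AnalyticOnNhd ℂ g (ball 0 1))
    (hω : ∀ z ∈ ball (0 : ℂ) 1, deriv g z = ω z * deriv h z)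
    (hω_lt : ∀ z ∈ ball (0 : ℂ) 1, ‖ω z‖ < Real.sin (δ * π / 4)) :
    HasOutwardCircles (fun z => h z + conj (g z)) := by
  have hlt : ∀ z ∈ ball (0 : ℂ) 1, ‖deriv g z‖ < Real.sin (δ * π / 4) * ‖deriv h z‖ := by
    intro z hz
    rw [hω z hz, norm_mul]
    exact mul_lt_mul_of_pos_right (hω_lt z hz) (norm_pos_iff.2 (hh.deriv_ne_zero hz))
  have hlt1 : ∀ z ∈ ball (0 : ℂ) 1, ‖deriv g z‖ < ‖deriv h z‖ := fun z hz =>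
    (hlt z hz).trans_le (mul_le_of_le_one_left (norm_nonneg _) (Real.sin_le_one _))
  have hsh : ∀ z ∈ ball (0 : ℂ) 1, HasStrictDerivAt h (deriv h z) z := fun z hz =>
    (hh.analytic z hz).hasStrictDerivAt
  have hsg : ∀ z ∈ ball (0 : ℂ) 1, HasStrictDerivAt g (deriv g z) z := fun z hz =>
    (hg z hz).hasStrictDerivAt
  refine ⟨fun a ha => map_nhds_add_conj (hsh a ha) (hsg a ha) (hlt1 a ha),
    fun a ha => isPositiveZero_add_conj (hsh a ha) (hsg a ha) (hlt1 a ha), fun r hr hr1 => ?_⟩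
  obtain ⟨H, s, hsc, hsm, hsp, hHs, hH⟩ := hh.exists_angle hr hr1
  refine ⟨s, fun θ => ?_, fun θ => ?_, hsc, hsm, hsp⟩
  · set z : ℂ := r * exp (θ * I) with hzdef
    have hzn : ‖z‖ = r := by
      rw [hzdef, norm_mul, norm_exp_ofReal_mul_I, norm_real, Real.norm_of_nonneg hr.le, mul_one]
    have hz : z ∈ ball (0 : ℂ) 1 := by rwa [mem_ball_zero_iff, hzn]
    have hzd : HasDerivAt (fun θ : ℝ => (r * exp (θ * I) : ℂ)) (z * I) θ := by
      have h1 : HasDerivAt (fun θ : ℝ => (θ * I : ℂ)) I θ := by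
        simpa using (ofRealCLM.hasDerivAt (x := θ)).mul_const I
      simpa [hzdef, mul_assoc] using h1.cexp.const_mul (r : ℂ)
    have h1 := (hsh z hz).hasDerivAt.comp_of_eq θ hzd rfl
    have h2 := (hsg z hz).hasDerivAt.comp_of_eq θ hzd rfl
    have h3 := conjCLE.toContinuousLinearMap.hasFDerivAt.comp_hasDerivAt θ h2
    refine ⟨_, h1.add h3, ?_⟩
    -- Modulo the rotation, the tangent is `i (z h' - conj (z g'))`, and `z h'` has argument `H θ`.
    have e1 : (deriv h z * (z * I) + conj (deriv g z * (z * I))) * exp (-(s θ * I))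
        = I * ((r * ‖deriv h z‖ : ℝ) * exp ((H θ - s θ : ℝ) * I)
          - conj (z * deriv g z) * exp ((-s θ : ℝ) * I)) := by
      have : exp (((H θ - s θ : ℝ) : ℂ) * I) = exp (H θ * I) * exp ((-s θ : ℝ) * I) := by
        rw [← Complex.exp_add]; congr 1; push_cast; ring
      rw [this, show (-(s θ * I) : ℂ) = ((-s θ : ℝ) : ℂ) * I by push_cast; ring]
      have e := hH θ
      rw [← hzdef] at e
      simp only [map_mul, conj_I]
      linear_combination I * exp (((-s θ : ℝ) : ℂ) * I) * e
    change 0 < ((deriv h z * (z * I) + conj (deriv g z * (z * I))) * exp (-(s θ * I))).im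
    rw [e1, I_mul_im, sub_re, re_ofReal_mul, exp_ofReal_mul_I_re]
    have e2 : (conj (z * deriv g z) * exp ((-s θ : ℝ) * I)).re ≤ r * ‖deriv g z‖ := by
      refine (re_le_norm _).trans ?_
      rw [norm_mul, norm_exp_ofReal_mul_I, RCLike.norm_conj, norm_mul, hzn, mul_one]
    -- The bound `K ≤ 4 - δ` enters here: `(K - 2)π/4 ≤ π/2 - δπ/4`.
    have e3 : Real.sin (δ * π / 4) ≤ Real.cos (H θ - s θ) := by
      rw [← Real.cos_pi_div_two_sub, ← Real.cos_abs (H θ - s θ)]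
      have := hHs θ
      have hπ := Real.pi_pos
      refine Real.cos_le_cos_of_nonneg_of_le_pi (abs_nonneg _) (by nlinarith) (this.trans ?_)
      nlinarith
    have e4 : r * ‖deriv g z‖ < r * (Real.sin (δ * π / 4) * ‖deriv h z‖) :=
      mul_lt_mul_of_pos_left (hlt z hz) hr
    have e5 : Real.sin (δ * π / 4) * (r * ‖deriv h z‖) ≤
        Real.cos (H θ - s θ) * (r * ‖deriv h z‖) := by gcongr
    linarith
  · have : exp (((θ + 2 * π : ℝ) : ℂ) * I) = exp (θ * I) := by
      rw [Complex.exp_eq_exp_iff_exists_int]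
      exact ⟨1, by push_cast; ring⟩
    simp only [this]

theorem mainTheorem2 (K δ : ℝ) (h g ω : ℂ → ℂ)
    (hδ0 : 0 ≤ δ) (hδ2 : δ ≤ 2) (hK2 : 2 ≤ K) (hK : K ≤ 4 - δ)
    (hh : BoundaryRotationClass K h)
    (hg : AnalyticOnNhd ℂ g (ball 0 1))
    (hω : ∀ z ∈ ball (0 : ℂ) 1, deriv g z = ω z * deriv h z)
    (hω_lt : ∀ z ∈ ball (0 : ℂ) 1, ‖ω z‖ < Real.sin (δ * π / 4)) :
    IsCloseToConvexOnDisk (fun z => h z + conj (g z)) ∧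
      IsUnivalentOnDisk (fun z => h z + conj (g z)) := by
  have hf := hasOutwardCircles_add_conj hδ0 hK hh hg hω hω_lt
  exact ⟨hf.isCloseToConvexOnDisk, hf.injOn⟩
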